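/- Let $\Sigma$ be a finite non-empty alphabet and $I\subseteq\Sigma\times\Sigma$ an irreflexive, symmetric independence relation, with dependence relation $D=\Sigma^2\setminus I$. The dependence graph of a finite or infinite word $w$ over $\Sigma$ has the positions of $w$ as vertices, each labelled by its letter, and an edge from $i$ to $j$ whenever $i<j$ and the letters at $i$ and $j$ are dependent. Two finite words, or two infinite words, are trace equivalent if their dependence graphs are isomorphic as labelled graphs. The classes of finite words are the finite traces, and $\Gamma$ maps a finite word to its trace. A language of finite (infinite) words is trace-closed if it is a union of classes of trace equivalence. For $K\subseteq\Sigma^*$ let $\lim(K)\subseteq\Sigma^\omega$ be the set of infinite words with infinitely many prefixes in $K$. A trace-closed $K$ is limit-stable if $\lim(K)$ is trace-closed as well. Then there is an algorithm (one fixed program of a unit-cost random access machine whose words have $O(\log N)$ bits on inputs occupying $N$ words) that does the following. Its input is a pair $(\Sigma,I)$ as above together with a minimal complete DFA $\mathcal{A}_K$, with state set $Q$, of a language $K=\Gamma^{-1}(T)$, where $T$ is a recognizable language of finite traces (that is, $\Gamma^{-1}(T)$ is regular); states and letters are numbered, and $I$, the transition function and the set of final states are given as tables. The algorithm decides whether $K$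 is limit-stable, and it does so in time $O\bigl(|Q|^2\cdot|\Sigma|\cdot(|\Sigma|+\log|Q|)\bigr)$, with a constant that does not depend on $\Sigma$, $I$ or $K$. -/

import Mathlib

/-! ## Traces -/

/-- `I` is an independence relation: irreflexive and symmetric. Its complement is the dependence
relation `D`. -/
structure IsIndependence {α : Type*} (I : α → α → Prop) : Prop where
  irrefl : ∀ a, ¬ I a a
  symm : ∀ a b, I a b → I b a

/-- A directed graph with vertices labelled by letters. -/
structure LabelledGraph (α : Type*) where
  V : Type
  lab : V → α
  E : V → V → Prop

/-- Isomorphism of labelled graphs. -/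
def LabelledGraph.Isomorphic {α : Type*} (G H : LabelledGraph α) : Prop :=
  ∃ e : G.V ≃ H.V, (∀ v, H.lab (e v) = G.lab v) ∧ ∀ v w, H.E (e v) (e w) ↔ G.E v w

theorem LabelledGraph.Isomorphic.refl {α : Type*} (G : LabelledGraph α) : G.Isomorphic G :=
  ⟨Equiv.refl _, fun _ => rfl, fun _ _ => Iff.rfl⟩

theorem LabelledGraph.Isomorphic.symm {α : Type*} {G H : LabelledGraph α}
    (h : G.Isomorphic H) : H.Isomorphic G := by
  obtain ⟨e, h1, h2⟩ := h
  exact ⟨e.symm, fun v => by simp [← h1], fun v w => by simp [← h2]⟩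

theorem LabelledGraph.Isomorphic.trans {α : Type*} {G H J : LabelledGraph α}
    (h : G.Isomorphic H) (h' : H.Isomorphic J) : G.Isomorphic J := by
  obtain ⟨e, h1, h2⟩ := h
  obtain ⟨f, h3, h4⟩ := h'
  exact ⟨e.trans f, fun v => by simp [h1, h3], fun v w => by simp [h2, h4]⟩

/-- The dependence graph of a finite word: its vertices are the positions of the word, and an edge
leads from each position to every later position that carries a dependent letter. -/
def depGraph {α : Type*} (I : α → α → Prop) (u : List α) : LabelledGraph α where
  V := Fin u.length
  lab := u.get
  E := fun i j => i < j ∧ ¬ I (u.get i) (u.get j)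

/-- The dependence graph of an infinite word. -/
def omegaDepGraph {α : Type*} (I : α → α → Prop) (x : ℕ → α) : LabelledGraph α where
  V := ℕ
  lab := x
  E := fun i j => i < j ∧ ¬ I (x i) (x j)

/-- Two finite words are trace equivalent if they have the same dependence graph up to
isomorphism. -/
def traceSetoid {α : Type*} (I : α → α → Prop) : Setoid (List α) where
  r u v := (depGraph I u).Isomorphic (depGraph I v)
  iseqv := ⟨fun _ => .refl _, fun h => h.symm, fun h h' => h.trans h'⟩

/-- The set `𝕄(Σ, I)` of finite traces. -/
def FiniteTrace {α : Type*} (I : α → α → Prop) : Type _ := Quotient (traceSetoid I)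

/-- The canonical map `Γ` from finite words to finite traces. -/
def toTrace {α : Type*} (I : α → α → Prop) (u : List α) : FiniteTrace I :=
  Quotient.mk (traceSetoid I) u

/-- The word language `Γ⁻¹(T)` of all linearizations of traces in `T`. -/
def linearizations {α : Type*} {I : α → α → Prop} (T : Set (FiniteTrace I)) : Language α :=
  {u | toTrace I u ∈ T}

/-- `T` is a recognizable language of finite traces. -/
def IsRecognizable {α : Type*} {I : α → α → Prop} (T : Set (FiniteTrace I)) : Prop :=
  (linearizations T).IsRegular

/-- Trace equivalence of infinite words. -/
def OmegaTraceEquiv {α : Type*} (I : α → α → Prop) (x y : ℕ → α) : Prop :=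
  (omegaDepGraph I x).Isomorphic (omegaDepGraph I y)

/-- A language of finite words is trace-closed if it is a union of classes of trace equivalence. -/
def TraceClosed {α : Type*} (I : α → α → Prop) (K : Language α) : Prop :=
  ∀ u v, toTrace I u = toTrace I v → u ∈ K → v ∈ K

/-- A language of infinite words is trace-closed if it is a union of classes of trace
equivalence. -/
def OmegaTraceClosed {α : Type*} (I : α → α → Prop) (L : Set (ℕ → α)) : Prop :=
  ∀ x y, OmegaTraceEquiv I x y → x ∈ L → y ∈ L

/-- `lim K`: the infinite words that have infinitely many finite prefixes in `K`. -/
def limLanguage {α : Type*} (K : Language α) : Set (ℕ → α) :=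
  {x | {m : ℕ | List.ofFn (fun i : Fin m => x i) ∈ K}.Infinite}

/-- `K` is limit-stable: it is trace-closed, and so is `lim K`. -/
def LimitStable {α : Type*} (I : α → α → Prop) (K : Language α) : Prop :=
  TraceClosed I K ∧ OmegaTraceClosed I (limLanguage K)

/-- `M` is a minimal (complete) DFA for `K`: it accepts `K` and no DFA with fewer states does. -/
def IsMinimalDFA {α : Type*} {n : ℕ} (M : DFA α (Fin n)) (K : Language α) : Prop :=
  M.accepts = K ∧ ∀ (m : ℕ) (M' : DFA α (Fin m)), M'.accepts = K → n ≤ m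

/-! ## Random access machines with unit cost and bounded words -/

/-- A machine state: registers, and a memory that is addressed by the contents of registers. -/
structure RamState where
  reg : ℕ → ℕ
  mem : ℕ → ℕ

/-- Write `v` to register `x`. -/
def RamState.setReg (s : RamState) (x v : ℕ) : RamState :=
  { s with reg := Function.update s.reg x v }

/-- Write `v` to the memory cell with address `i`. -/
def RamState.setMem (s : RamState) (i v : ℕ) : RamState :=
  { s with mem := Function.update s.mem i v }

/-- Tests: comparison of two registers. -/
inductive RamTest where
  | lt (x y : ℕ)
  | eq (x y : ℕ)

/-- The test succeeds in the given state. -/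
def RamTest.Holds : RamTest → RamState → Prop
  | .lt x y, s => s.reg x < s.reg y
  | .eq x y, s => s.reg x = s.reg y

/-- Programs. All arguments that name a register are fixed numbers, so that a program uses finitely
many registers; the memory is reached only through `load` and `store`. -/
inductive RamProg where
  /-- do nothing -/
  | skip
  /-- `R x := c` -/
  | const (x c : ℕ)
  /-- `R x := R y` -/
  | copy (x y : ℕ)
  /-- `R x := R y + R z` -/
  | add (x y z : ℕ)
  /-- `R x := R y - R z`, truncated at 0 -/
  | sub (x y z : ℕ)
  /-- `R x := R y * R z` -/
  | mul (x y z : ℕ)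
  /-- `R x := M[R y]` -/
  | load (x y : ℕ)
  /-- `M[R x] := R y` -/
  | store (x y : ℕ)
  /-- sequential composition -/
  | seq (p q : RamProg)
  /-- if the test succeeds then `p` else `q` -/
  | branch (b : RamTest) (p q : RamProg)
  /-- while the test succeeds, do `p` -/
  | loop (b : RamTest) (p : RamProg)

/-- `RamExec W P s t s'`: started in `s`, the program `P` terminates in `s'` after exactly `t`
steps. Each basic instruction and each evaluation of a test is one step. Machine words hold the
numbers below `W`: a computation that produces a larger number is stuck, hence has no terminating
execution. -/
inductive RamExec (W : ℕ) : RamProg → RamState → ℕ → RamState → Prop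
  | skip (s : RamState) : RamExec W .skip s 1 s
  | const (s : RamState) (x c : ℕ) (h : c < W) : RamExec W (.const x c) s 1 (s.setReg x c)
  | copy (s : RamState) (x y : ℕ) : RamExec W (.copy x y) s 1 (s.setReg x (s.reg y))
  | add (s : RamState) (x y z : ℕ) (h : s.reg y + s.reg z < W) :
      RamExec W (.add x y z) s 1 (s.setReg x (s.reg y + s.reg z))
  | sub (s : RamState) (x y z : ℕ) :
      RamExec W (.sub x y z) s 1 (s.setReg x (s.reg y - s.reg z))
  | mul (s : RamState) (x y z : ℕ) (h : s.reg y * s.reg z < W) :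
      RamExec W (.mul x y z) s 1 (s.setReg x (s.reg y * s.reg z))
  | load (s : RamState) (x y : ℕ) :
      RamExec W (.load x y) s 1 (s.setReg x (s.mem (s.reg y)))
  | store (s : RamState) (x y : ℕ) :
      RamExec W (.store x y) s 1 (s.setMem (s.reg x) (s.reg y))
  | seq {p q : RamProg} {s s' s'' : RamState} {t t' : ℕ}
      (h : RamExec W p s t s') (h' : RamExec W q s' t' s'') :
      RamExec W (.seq p q) s (t + t') s''
  | branchTrue {b : RamTest} {p q : RamProg} {s s' : RamState} {t : ℕ}
      (hb : b.Holds s) (h : RamExec W p s t s') : RamExec W (.branch b p q) s (1 + t) s'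
  | branchFalse {b : RamTest} {p q : RamProg} {s s' : RamState} {t : ℕ}
      (hb : ¬ b.Holds s) (h : RamExec W q s t s') : RamExec W (.branch b p q) s (1 + t) s'
  | loopTrue {b : RamTest} {p : RamProg} {s s' s'' : RamState} {t t' : ℕ}
      (hb : b.Holds s) (h : RamExec W p s t s') (h' : RamExec W (.loop b p) s' t' s'') :
      RamExec W (.loop b p) s (1 + t + t') s''
  | loopFalse {b : RamTest} {p : RamProg} {s : RamState}
      (hb : ¬ b.Holds s) : RamExec W (.loop b p) s 1 s

/-- The initial state: the input stands in the first memory cells, everything else is 0. -/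
def ramInit (input : List ℕ) : RamState where
  reg := fun _ => 0
  mem := fun i => input.getD i 0

open Classical in
/-- The truth value of a proposition as a number. -/
noncomputable def truthBit (p : Prop) : ℕ := if p then 1 else 0

/-- The input: the number of states, the number of letters, the initial state, the characteristic
vector of the set of final states, the transition table (row by row, one row for each state), and
the matrix of the independence relation (row by row). -/
noncomputable def encodeInput {k n : ℕ} (I : Fin k → Fin k → Prop) (M : DFA (Fin k) (Fin n)) :
    List ℕ :=
  [n, k, (M.start : ℕ)]
    ++ List.ofFn (fun q : Fin n => truthBit (q ∈ M.accept))
    ++ List.ofFn (fun i : Fin (n * k) => (M.step i.divNat i.modNat : ℕ))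
    ++ List.ofFn (fun i : Fin (k * k) => truthBit (I i.divNat i.modNat))

open Relation

/-! ## Adjacent swaps of independent letters -/

/-- One exchange of two adjacent independent letters. -/
inductive TraceSwap {α : Type*} (I : α → α → Prop) : List α → List α → Prop
  | swap (r : List α) (a b : α) (s : List α) (h : I a b) :
      TraceSwap I (r ++ a :: b :: s) (r ++ b :: a :: s)

/-- Reachability by exchanges of adjacent independent letters. -/
abbrev SwapEquiv {α : Type*} (I : α → α → Prop) : List α → List α → Prop :=
  ReflTransGen (TraceSwap I)

theorem TraceSwap.cons {α : Type*} {I : α → α → Prop} (c : α) {u v : List α}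
    (h : TraceSwap I u v) : TraceSwap I (c :: u) (c :: v) := by
  obtain ⟨r, a, b, s, h⟩ := h
  exact TraceSwap.swap (c :: r) a b s h

theorem SwapEquiv.cons {α : Type*} {I : α → α → Prop} (c : α) {u v : List α}
    (h : SwapEquiv I u v) : SwapEquiv I (c :: u) (c :: v) :=
  ReflTransGen.lift (c :: ·) (fun _ _ h => TraceSwap.cons c h) _ _ h

theorem TraceSwap.symm {α : Type*} {I : α → α → Prop} (hI : ∀ a b, I a b → I b a) {u v : List α}
    (h : TraceSwap I u v) : TraceSwap I v u := by
  obtain ⟨r, a, b, s, h⟩ := h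
  exact TraceSwap.swap r b a s (hI _ _ h)

theorem SwapEquiv.move_front {α : Type*} {I : α → α → Prop} (c : α) (s t : List α)
    (h : ∀ d ∈ s, I c d) : SwapEquiv I (c :: (s ++ t)) (s ++ c :: t) := by
  induction s with
  | nil => exact ReflTransGen.refl
  | cons d s ih =>
    refine ReflTransGen.head (TraceSwap.swap [] c d (s ++ t) (h d (by simp))) ?_
    exact SwapEquiv.cons d (ih fun e he => h e (by simp [he]))

/-- Two orderings of the same events that both respect the order `R` between dependent events have
swap equivalent label sequences. -/
theorem SwapEquiv.of_linearizations {α ε : Type*} [DecidableEq ε] {I : α → α → Prop}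
    (lab : ε → α) (R : ε → ε → Prop)
    (hR : ∀ i j, i ≠ j → ¬ I (lab i) (lab j) → R i j ∨ R j i) (l : List ε) :
    ∀ l' : List ε, l.Perm l' → l.Nodup → l.Pairwise (fun i j => ¬ R j i) →
      l'.Pairwise (fun i j => ¬ R j i) → SwapEquiv I (l.map lab) (l'.map lab) := by
  induction l with
  | nil =>
    intro l' hp _ _ _
    rw [List.nil_perm.mp hp]
  | cons i l ih =>
    intro l' hp hn h1 h2
    have hi : i ∈ l' := hp.subset (by simp)
    obtain ⟨s, t, rfl⟩ := List.append_of_mem hi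
    have hp' : l.Perm (s ++ t) := (hp.trans List.perm_middle).cons_inv
    rw [List.nodup_cons] at hn
    rw [List.pairwise_cons] at h1
    have hst : (s ++ t).Pairwise (fun i j => ¬ R j i) :=
      h2.sublist (List.Sublist.append_left (List.sublist_cons_self i t) s)
    refine (SwapEquiv.cons (lab i) (ih (s ++ t) hp' hn.2 h1.2 hst)).trans ?_
    rw [List.map_append, List.map_append, List.map_cons]
    refine SwapEquiv.move_front _ _ _ ?_
    intro d hd
    obtain ⟨j, hj, rfl⟩ := List.mem_map.mp hd
    have hjl : j ∈ l := hp'.mem_iff.mpr (by simp [hj])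
    by_contra hd
    have hne : i ≠ j := fun h => hn.1 (h ▸ hjl)
    rcases hR i j hne hd with h | h
    · rw [List.pairwise_append] at h2
      exact h2.2.2 j hj i (by simp) h
    · exact h1.1 j hjl h

theorem TraceSwap.isomorphic {α : Type*} {I : α → α → Prop} (hI : IsIndependence I)
    {u v : List α} (h : TraceSwap I u v) : (depGraph I u).Isomorphic (depGraph I v) := by
  obtain ⟨r, a, b, s, hab⟩ := h
  have hba := hI.symm _ _ hab
  let σ : Equiv.Perm ℕ := Equiv.swap r.length (r.length + 1)
  have hσ : ∀ i, σ i = if i = r.length then r.length + 1 else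
      if i = r.length + 1 then r.length else i := fun i => Equiv.swap_apply_def _ _ _
  have hσσ : ∀ i, σ (σ i) = i := fun i => Equiv.swap_apply_self _ _ _
  have hlen : (r ++ a :: b :: s).length = (r ++ b :: a :: s).length := by simp
  have hlt : ∀ i, i < (r ++ a :: b :: s).length → σ i < (r ++ a :: b :: s).length := by
    intro i hi
    rw [hσ]
    simp only [List.length_append, List.length_cons] at hi ⊢
    split_ifs <;> omega
  have hlab : ∀ i, (r ++ b :: a :: s)[σ i]? = (r ++ a :: b :: s)[i]? := by
    intro i
    rw [hσ]
    split_ifs with h1 h2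
    · subst h1; simp
    · subst h2; simp
    · rcases lt_or_ge i r.length with h | h
      · rw [List.getElem?_append_left h, List.getElem?_append_left h]
      · rw [List.getElem?_append_right h, List.getElem?_append_right h]
        obtain ⟨m, hm⟩ : ∃ m, i - r.length = m + 2 := ⟨i - r.length - 2, by omega⟩
        simp [hm]
  have hl : ∀ i : Fin (r ++ a :: b :: s).length,
      (r ++ b :: a :: s)[σ i]'(hlen ▸ hlt i i.2) = (r ++ a :: b :: s)[i.1] := by
    intro i
    have := hlab i.1
    rw [List.getElem?_eq_getElem i.2, List.getElem?_eq_getElem ((hlt i i.2).trans_eq hlen)] at this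
    exact Option.some.inj this
  let e : Fin (r ++ a :: b :: s).length ≃ Fin (r ++ b :: a :: s).length :=
    ⟨fun i => ⟨σ i, (hlt i i.2).trans_eq hlen⟩, fun i => ⟨σ i, hlt i (i.2.trans_eq hlen.symm)⟩,
      fun i => Fin.ext (hσσ i), fun i => Fin.ext (hσσ i)⟩
  refine ⟨e, hl, fun (i : Fin _) (j : Fin _) => ?_⟩
  · change (σ i < σ j ∧ ¬ I ((r ++ b :: a :: s)[σ i]'((hlt i i.2).trans_eq hlen))
      ((r ++ b :: a :: s)[σ j]'(hlen ▸ hlt j j.2))) ↔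
      (i.1 < j.1 ∧ ¬ I (r ++ a :: b :: s)[i.1] (r ++ a :: b :: s)[j.1])
    rw [hl, hl]
    refine and_congr_left fun hd => ?_
    have ha : ∀ h, (r ++ a :: b :: s)[r.length]'h = a := by intro h; simp
    have hb : ∀ h, (r ++ a :: b :: s)[r.length + 1]'h = b := by intro h; simp
    rcases i with ⟨i, hi⟩
    rcases j with ⟨j, hj⟩
    dsimp only at hd ⊢
    have key : ¬ (i = r.length ∧ j = r.length + 1) ∧ ¬ (j = r.length ∧ i = r.length + 1) := by
      constructor
      · rintro ⟨rfl, rfl⟩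
        rw [ha, hb] at hd
        exact hd hab
      · rintro ⟨rfl, rfl⟩
        rw [ha, hb] at hd
        exact hd hba
    rw [hσ, hσ]
    split_ifs <;> omega

/-! ## Minimal automata -/

theorem IsMinimalDFA.surjective_injective {α : Type*} {n : ℕ} {M : DFA α (Fin n)} {K : Language α}
    (h : IsMinimalDFA M K) :
    Function.Surjective M.eval ∧ Function.Injective M.acceptsFrom := by
  obtain ⟨rfl, hmin⟩ := h
  have hq : ∀ u, M.accepts.leftQuotient u = M.acceptsFrom (M.eval u) :=
    fun u => Language.leftQuotient_accepts_apply M u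
  have hsub : Set.range M.accepts.leftQuotient ⊆ M.acceptsFrom '' Set.range M.eval := by
    rintro _ ⟨u, rfl⟩
    exact ⟨M.eval u, ⟨u, rfl⟩, (hq u).symm⟩
  have hfin : (Set.range M.accepts.leftQuotient).Finite := (Set.toFinite _).subset hsub
  have hcard : n ≤ (Set.range M.accepts.leftQuotient).ncard := by
    have : Fintype (Set.range M.accepts.leftQuotient) := hfin.fintype
    have e := Fintype.equivFin (Set.range M.accepts.leftQuotient)
    have h1 := hmin _ (M.accepts.toDFA.reindex e) (by simp)
    rwa [← Nat.card_eq_fintype_card, Nat.card_coe_set_eq] at h1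
  have h2 : (Set.range M.accepts.leftQuotient).ncard ≤ (M.acceptsFrom '' Set.range M.eval).ncard :=
    Set.ncard_le_ncard hsub (Set.toFinite _)
  have h3 : (M.acceptsFrom '' Set.range M.eval).ncard ≤ (Set.range M.eval).ncard :=
    Set.ncard_image_le (Set.toFinite _)
  have h4 : (Set.range M.eval).ncard ≤ n := by
    simpa using Set.ncard_le_card (Set.range M.eval)
  have huniv : Set.range M.eval = Set.univ := by
    refine Set.eq_of_subset_of_ncard_le (Set.subset_univ _) ?_ (Set.toFinite _)
    rw [Set.ncard_univ, Nat.card_eq_fintype_card, Fintype.card_fin]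
    omega
  refine ⟨Set.range_eq_univ.mp huniv, ?_⟩
  have hinj := Set.injOn_of_ncard_image_eq (f := M.acceptsFrom) (s := Set.range M.eval) (by omega)
    (Set.toFinite _)
  rw [huniv] at hinj
  exact Set.injOn_univ.mp hinj

/-- Independent letters commute in a minimal automaton of a trace-closed language. -/
theorem IsMinimalDFA.step_comm {α : Type*} {n : ℕ} {I : α → α → Prop} (hI : IsIndependence I)
    {M : DFA α (Fin n)} {K : Language α} (h : IsMinimalDFA M K) (hK : TraceClosed I K)
    (q : Fin n) {a b : α} (hab : I a b) :
    M.step (M.step q a) b = M.step (M.step q b) a := by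
  obtain ⟨hs, hi⟩ := h.surjective_injective
  obtain ⟨u, rfl⟩ := hs q
  have hmem : ∀ c d : α, I c d → ∀ w, w ∈ M.acceptsFrom (M.step (M.step (M.eval u) c) d) →
      w ∈ M.acceptsFrom (M.step (M.step (M.eval u) d) c) := by
    intro c d hcd w hw
    have hev : ∀ c d : α, w ∈ M.acceptsFrom (M.step (M.step (M.eval u) c) d) ↔
        u ++ c :: d :: w ∈ K := by
      intro c d
      rw [← h.1, DFA.mem_accepts, DFA.mem_acceptsFrom, DFA.eval, DFA.evalFrom_of_append]
      simp
    rw [hev] at hw ⊢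
    exact hK _ _ (Quotient.sound (TraceSwap.isomorphic hI (TraceSwap.swap u c d w hcd))) hw
  exact hi (Set.ext fun w => ⟨hmem a b hab w, hmem b a (hI.symm _ _ hab) w⟩)

theorem traceClosed_linearizations {α : Type*} {I : α → α → Prop} (T : Set (FiniteTrace I)) :
    TraceClosed I (linearizations T) := by
  intro u v huv hu
  change toTrace I v ∈ T
  rw [← huv]
  exact hu

/-! ## Infinite words -/

/-- The prefix of length `m` of an infinite word. -/
def wordPrefix {α : Type*} (x : ℕ → α) (m : ℕ) : List α := (List.range m).map x

theorem wordPrefix_succ {α : Type*} (x : ℕ → α) (m : ℕ) :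
    wordPrefix x (m + 1) = wordPrefix x m ++ [x m] := by
  simp [wordPrefix, List.range_succ]

theorem mem_limLanguage_iff {α : Type*} {K : Language α} {x : ℕ → α} :
    x ∈ limLanguage K ↔ ∀ N, ∃ m, N ≤ m ∧ wordPrefix x m ∈ K := by
  have h : ∀ m, List.ofFn (fun i : Fin m => x i) = wordPrefix x m := by
    intro m
    refine List.ext_getElem (by simp [wordPrefix]) ?_
    intro i h1 h2
    simp [wordPrefix]
  simp only [limLanguage, Set.mem_ofPred_eq, h, Set.infinite_iff_exists_gt]
  constructor
  · intro H N
    obtain ⟨m, hm, hN⟩ := H N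
    exact ⟨m, hN.le, hm⟩
  · intro H N
    obtain ⟨m, hN, hm⟩ := H (N + 1)
    exact ⟨m, hm, hN⟩

/-- A factor of a prefix of `y` that is long enough to cover a given prefix of `x`, for trace
equivalent `x` and `y`. -/
theorem OmegaTraceEquiv.exists_factor {α : Type*} {I : α → α → Prop}
    (hI : IsIndependence I) {x y : ℕ → α} (h : OmegaTraceEquiv I x y) (m₁ : ℕ) :
    ∃ N, ∀ M, N ≤ M → ∃ v, SwapEquiv I (wordPrefix y m₁ ++ v) (wordPrefix x M) ∧
      ∃ N', ∀ m₂, N' ≤ m₂ → m₁ ≤ m₂ ∧ ∃ u, SwapEquiv I (v ++ u)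
        ((List.range' m₁ (m₂ - m₁)).map y) := by
  obtain ⟨e', hlab', hE'⟩ := h
  let e : ℕ ≃ ℕ := e'
  have hlab : ∀ i, y (e i) = x i := hlab'
  have hE : ∀ i j, (e i < e j ∧ ¬ I (y (e i)) (y (e j))) ↔ (i < j ∧ ¬ I (x i) (x j)) := hE'
  let R : ℕ → ℕ → Prop := fun i j => i < j ∧ ¬ I (y i) (y j)
  have hR : ∀ i j, i ≠ j → ¬ I (y i) (y j) → R i j ∨ R j i := by
    intro i j hne hd
    rcases lt_or_gt_of_ne hne with h | h
    · exact Or.inl ⟨h, hd⟩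
    · exact Or.inr ⟨h, fun h' => hd (hI.symm _ _ h')⟩
  have hlt : ∀ l : List ℕ, l.Pairwise (· < ·) → l.Pairwise (fun i j => ¬ R j i) :=
    fun l hl => hl.imp fun h h' => absurd h'.1 (by omega)
  have hEx : ∀ M, ((List.range M).map e).Pairwise (fun i j => ¬ R j i) := by
    intro M
    rw [List.pairwise_map]
    refine List.pairwise_lt_range.imp ?_
    intro i j hij hR'
    exact absurd ((hE j i).mp hR').1 (by omega)
  have hexn : ∀ M, ((List.range M).map e).Nodup :=
    fun M => List.nodup_range.map e.injective
  have hbound : ∀ (f : ℕ → ℕ) (m : ℕ), ∃ N, ∀ i < m, f i < N := by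
    intro f m
    refine ⟨(Finset.range m).sup f + 1, fun i hi => ?_⟩
    exact Nat.lt_succ_of_le (Finset.le_sup (f := f) (Finset.mem_range.mpr hi))
  obtain ⟨N, hN⟩ := hbound e.symm m₁
  have hmemx : ∀ M j, j ∈ (List.range M).map e ↔ e.symm j < M := by
    intro M j
    simp only [List.mem_map, List.mem_range]
    constructor
    · rintro ⟨i, hi, rfl⟩
      simpa using hi
    · intro h
      exact ⟨e.symm j, h, by simp⟩
  refine ⟨N, fun M hM => ?_⟩
  let B := ((List.range M).map e).filter (fun j => decide (m₁ ≤ j))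
  have hmemB : ∀ j, j ∈ B ↔ e.symm j < M ∧ m₁ ≤ j := by
    intro j
    rw [List.mem_filter, hmemx]
    simp
  have hBn : B.Nodup := (hexn M).filter _
  have hBR : B.Pairwise (fun i j => ¬ R j i) := (hEx M).filter _
  refine ⟨B.map y, ?_, ?_⟩
  · have h1 : wordPrefix x M = ((List.range M).map e).map y := by
      simp [wordPrefix, Function.comp_def, hlab]
    rw [h1, wordPrefix, ← List.map_append]
    have hnod : (List.range m₁ ++ B).Nodup := by
      refine List.Nodup.append List.nodup_range hBn ?_
      intro j hj hj'
      have := (hmemB j).mp hj'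
      have := List.mem_range.mp hj
      omega
    refine SwapEquiv.of_linearizations y R hR _ _ ?_ hnod ?_ (hEx M)
    · rw [List.perm_ext_iff_of_nodup hnod (hexn M)]
      intro j
      rw [List.mem_append, List.mem_range, hmemB, hmemx]
      constructor
      · rintro (h | h)
        · exact (hN j h).trans_le hM
        · exact h.1
      · intro h
        by_cases hj : j < m₁
        · exact Or.inl hj
        · exact Or.inr ⟨h, by omega⟩
    · rw [List.pairwise_append]
      refine ⟨hlt _ List.pairwise_lt_range, hBR, ?_⟩
      intro i hi j hj hR'
      have := (hmemB j).mp hj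
      have := List.mem_range.mp hi
      have := hR'.1
      omega
  · obtain ⟨N', hN'⟩ := hbound e M
    refine ⟨max N' m₁, fun m₂ hm₂ => ⟨le_of_max_le_right hm₂, ?_⟩⟩
    have hm₂' := le_of_max_le_left hm₂
    have hm₁ := le_of_max_le_right hm₂
    let C := (List.range' m₁ (m₂ - m₁)).filter (fun j => decide (¬ e.symm j < M))
    have hmemr : ∀ j, j ∈ List.range' m₁ (m₂ - m₁) ↔ m₁ ≤ j ∧ j < m₂ := by
      intro j
      rw [List.mem_range'_1]
      omega
    have hmemC : ∀ j, j ∈ C ↔ (m₁ ≤ j ∧ j < m₂) ∧ ¬ e.symm j < M := by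
      intro j
      rw [List.mem_filter, hmemr]
      simp
    have hCn : C.Nodup := List.Nodup.filter _ List.nodup_range'
    refine ⟨C.map y, ?_⟩
    rw [← List.map_append]
    have hnod : (B ++ C).Nodup := by
      refine List.Nodup.append hBn hCn ?_
      intro j hj hj'
      exact ((hmemC j).mp hj').2 ((hmemB j).mp hj).1
    refine SwapEquiv.of_linearizations y R hR _ _ ?_ hnod ?_ (hlt _ List.pairwise_lt_range')
    · rw [List.perm_ext_iff_of_nodup hnod List.nodup_range']
      intro j
      rw [List.mem_append, hmemr, hmemB, hmemC]
      have : e.symm j < M → j < m₂ := by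
        intro h
        have := hN' _ h
        rw [Equiv.apply_symm_apply] at this
        omega
      tauto
    · rw [List.pairwise_append]
      refine ⟨hBR, hlt _ (List.Pairwise.filter _ List.pairwise_lt_range'), ?_⟩
      intro i hi j hj hR'
      have h1 := (hmemB i).mp hi
      have h2 := (hmemC j).mp hj
      refine h2.2 (lt_trans ?_ h1.1)
      have := (hE (e.symm j) (e.symm i)).mp (by simpa using hR')
      exact this.1

/-! ## The local criterion -/

/-- A transition into a nonfinal state. -/
def AvoidStep {α σ : Type*} (M : DFA α σ) (q q' : σ) : Prop :=
  q' ∉ M.accept ∧ ∃ a, M.step q a = q'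

/-- Exchanging two adjacent independent letters on a cycle of nonfinal states makes the cycle visit
a final state. -/
def HasUnstableSwap {α σ : Type*} (I : α → α → Prop) (M : DFA α σ) : Prop :=
  ∃ p a b, I a b ∧ M.step p a ∈ M.accept ∧ p ∉ M.accept ∧ M.step p b ∉ M.accept ∧
    M.step (M.step p b) a ∉ M.accept ∧ ReflTransGen (AvoidStep M) (M.step (M.step p b) a) p

/-- All states on the run from `q` on `w` are nonfinal. -/
def RunAvoids {α σ : Type*} (M : DFA α σ) (q : σ) (w : List α) : Prop :=
  ∀ u v, u ++ v = w → M.evalFrom q u ∉ M.accept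

theorem runAvoids_append {α σ : Type*} {M : DFA α σ} {q : σ} {u v : List α} :
    RunAvoids M q (u ++ v) ↔ RunAvoids M q u ∧ RunAvoids M (M.evalFrom q u) v := by
  constructor
  · intro h
    refine ⟨fun u₁ u₂ hu => h u₁ (u₂ ++ v) (by simp [← hu]), fun v₁ v₂ hv => ?_⟩
    rw [← DFA.evalFrom_of_append]
    exact h (u ++ v₁) v₂ (by simp [← hv])
  · rintro ⟨h1, h2⟩ w₁ w₂ hw
    rcases List.append_eq_append_iff.mp hw with ⟨t, rfl, rfl⟩ | ⟨t, rfl, rfl⟩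
    · exact h1 _ t rfl
    · rw [DFA.evalFrom_of_append]
      exact h2 _ _ rfl

theorem runAvoids_nil {α σ : Type*} {M : DFA α σ} {q : σ} :
    RunAvoids M q [] ↔ q ∉ M.accept := by
  constructor
  · intro h
    exact h [] [] rfl
  · intro h u v huv
    rw [(List.append_eq_nil_iff.mp huv).1]
    exact h

theorem runAvoids_cons {α σ : Type*} {M : DFA α σ} {q : σ} {a : α} {w : List α} :
    RunAvoids M q (a :: w) ↔ q ∉ M.accept ∧ RunAvoids M (M.step q a) w := by
  constructor
  · intro h
    exact ⟨h [] _ rfl, fun u v huv => h (a :: u) v (by simp [huv])⟩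
  · rintro ⟨h1, h2⟩ u v huv
    cases u with
    | nil => exact h1
    | cons b u =>
      obtain ⟨rfl, rfl⟩ := List.cons.inj huv
      exact h2 u v rfl

theorem RunAvoids.reflTransGen {α σ : Type*} {M : DFA α σ} (w : List α) :
    ∀ q, RunAvoids M q w → ReflTransGen (AvoidStep M) q (M.evalFrom q w) := by
  induction w with
  | nil => exact fun q _ => ReflTransGen.refl
  | cons a w ih =>
    intro q h
    rw [runAvoids_cons] at h
    exact ReflTransGen.head ⟨h.2 [] w rfl, a, rfl⟩ (ih _ h.2)

theorem exists_runAvoids {α σ : Type*} {M : DFA α σ} {q q' : σ} (hq : q ∉ M.accept)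
    (h : ReflTransGen (AvoidStep M) q q') : ∃ w, M.evalFrom q w = q' ∧ RunAvoids M q w := by
  induction h with
  | refl => exact ⟨[], rfl, runAvoids_nil.mpr hq⟩
  | tail _ h ih =>
    obtain ⟨w, rfl, hw⟩ := ih
    obtain ⟨hq', a, rfl⟩ := h
    refine ⟨w ++ [a], by simp, runAvoids_append.mpr ⟨hw, runAvoids_cons.mpr ⟨hw w [] (by simp), ?_⟩⟩⟩
    exact runAvoids_nil.mpr hq'

theorem SwapEquiv.evalFrom_eq {α σ : Type*} {I : α → α → Prop} {M : DFA α σ}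
    (hM : ∀ q a b, I a b → M.step (M.step q a) b = M.step (M.step q b) a) {u v : List α}
    (h : SwapEquiv I u v) (q : σ) : M.evalFrom q u = M.evalFrom q v := by
  induction h with
  | refl => rfl
  | tail _ h ih =>
    obtain ⟨r, a, b, s, hab⟩ := h
    rw [ih]
    simp [DFA.evalFrom_of_append, hM _ _ _ hab]

theorem SwapEquiv.runAvoids {α σ : Type*} {I : α → α → Prop}
    {M : DFA α σ} (hM : ∀ q a b, I a b → M.step (M.step q a) b = M.step (M.step q b) a)
    (hs : ¬ HasUnstableSwap I M) {u v : List α} (h : SwapEquiv I u v) {q : σ}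
    (hq : M.evalFrom q v = q) (hv : RunAvoids M q v) : RunAvoids M q u := by
  induction h with
  | refl => exact hv
  | tail _ h ih =>
    have hq' := SwapEquiv.evalFrom_eq hM (ReflTransGen.single h) q
    refine ih (hq'.trans hq) ?_
    obtain ⟨r, a, b, s, hab⟩ := h
    simp only [runAvoids_append, runAvoids_cons] at hv ⊢
    obtain ⟨h1, h2, h3, h4⟩ := hv
    refine ⟨h1, h2, ?_, by rwa [hM _ _ _ hab]⟩
    intro hfin
    refine hs ⟨M.evalFrom q r, a, b, hab, hfin, h2, h3, h4 [] s rfl, ?_⟩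
    have e : M.evalFrom (M.step (M.step (M.evalFrom q r) b) a) s = q := by
      simpa [DFA.evalFrom_of_append] using hq
    have := RunAvoids.reflTransGen s _ h4
    rw [e] at this
    exact this.trans (RunAvoids.reflTransGen r q h1)

theorem omegaTraceClosed_of_not_hasUnstableSwap {α σ : Type*} [Finite σ] {I : α → α → Prop}
    (hI : IsIndependence I) {M : DFA α σ}
    (hM : ∀ q a b, I a b → M.step (M.step q a) b = M.step (M.step q b) a)
    (hs : ¬ HasUnstableSwap I M) : OmegaTraceClosed I (limLanguage M.accepts) := by
  intro x y hxy hx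
  rw [mem_limLanguage_iff] at hx ⊢
  by_contra hy
  push Not at hy
  obtain ⟨N₀, hN₀⟩ := hy
  obtain ⟨q, hq⟩ := Finite.exists_infinite_fiber (fun m : ℕ => M.eval (wordPrefix y m))
  have hinf : ∀ N, ∃ m, N ≤ m ∧ M.eval (wordPrefix y m) = q := by
    intro N
    have := Set.infinite_coe_iff.mp hq
    obtain ⟨m, hm, hN⟩ := this.exists_gt N
    exact ⟨m, hN.le, hm⟩
  obtain ⟨m₁, hm₁, hq₁⟩ := hinf N₀
  obtain ⟨N, hN⟩ := hxy.exists_factor hI m₁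
  obtain ⟨m, hm, hacc⟩ := hx N
  obtain ⟨v, hv, N', hN'⟩ := hN m hm
  obtain ⟨m₂, hm₂, hq₂⟩ := hinf N'
  obtain ⟨h12, u, hu⟩ := hN' m₂ hm₂
  have hfac : ∀ j, wordPrefix y (m₁ + j) = wordPrefix y m₁ ++ (List.range' m₁ j).map y := by
    intro j
    rw [wordPrefix, wordPrefix, ← List.map_append, List.range_eq_range', List.range_eq_range']
    congr 1
    simpa using (List.range'_append (s := 0) (m := m₁) (n := j) (step := 1)).symm
  have hev : ∀ w, M.eval (wordPrefix y m₁ ++ w) = M.evalFrom q w := by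
    intro w
    rw [DFA.eval, DFA.evalFrom_of_append, ← DFA.eval, hq₁]
  have hcycle : M.evalFrom q ((List.range' m₁ (m₂ - m₁)).map y) = q := by
    rw [← hev, ← hfac, Nat.add_sub_cancel' h12, hq₂]
  have havoid : RunAvoids M q ((List.range' m₁ (m₂ - m₁)).map y) := by
    intro w₁ w₂ hw
    obtain ⟨l₁, l₂, hl, rfl, rfl⟩ := List.append_eq_map_iff.mp hw
    obtain ⟨j, hj, rfl, -⟩ := List.range'_eq_append_iff.mp hl
    rw [← hev, ← hfac]
    exact hN₀ _ (by omega)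
  have h := SwapEquiv.runAvoids hM hs hu hcycle havoid
  refine h v u rfl ?_
  rw [← hev]
  have e := SwapEquiv.evalFrom_eq hM hv M.start
  change M.eval _ = M.eval _ at e
  rw [e]
  exact hacc

/-- The infinite word `u w w w …`. -/
def lasso {α : Type*} (d : α) (u w : List α) (n : ℕ) : α :=
  if n < u.length then u.getD n d else w.getD ((n - u.length) % w.length) d

theorem eval_wordPrefix_lasso {α σ : Type*} {M : DFA α σ} {p : σ} (d : α) {u w : List α}
    (hw : 2 ≤ w.length) (hu : M.eval u = p) (hp : M.evalFrom p w = p) (m : ℕ) :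
    M.eval (wordPrefix (lasso d u w) (u.length + m)) = M.evalFrom p (w.take (m % w.length)) := by
  induction m with
  | zero =>
    have : wordPrefix (lasso d u w) (u.length + 0) = u := by
      refine List.ext_getElem (by simp [wordPrefix]) fun i h1 h2 => ?_
      simp [wordPrefix, lasso, h2]
    rw [this, hu]
    simp
  | succ m ih =>
    have hlt : m % w.length < w.length := Nat.mod_lt _ (by omega)
    have hstep : M.eval (wordPrefix (lasso d u w) (u.length + (m + 1))) =
        M.evalFrom p (w.take (m % w.length + 1)) := by
      rw [← Nat.add_assoc, wordPrefix_succ, DFA.eval_append_singleton, ih,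
        ← List.take_append_getElem hlt, DFA.evalFrom_append_singleton]
      simp [lasso, hlt]
    rw [hstep, Nat.add_mod, Nat.mod_eq_of_lt (a := 1) (by omega)]
    rcases Nat.lt_or_ge (m % w.length + 1) w.length with h | h
    · rw [Nat.mod_eq_of_lt h]
    · have h' : m % w.length + 1 = w.length := by omega
      rw [h', Nat.mod_self, List.take_length, hp]
      simp

theorem omegaTraceEquiv_lasso {α : Type*} {I : α → α → Prop} (hI : IsIndependence I) {a b : α}
    (hab : I a b) (d : α) (u s : List α) :
    OmegaTraceEquiv I (lasso d u (a :: b :: s)) (lasso d u (b :: a :: s)) := by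
  have hba := hI.symm _ _ hab
  set L := s.length + 2 with hL
  let σ : ℕ → ℕ := fun n => if n < u.length then n else
    if (n - u.length) % L = 0 then n + 1 else if (n - u.length) % L = 1 then n - 1 else n
  have hcase : ∀ n, (n < u.length ∧ σ n = n) ∨ (u.length ≤ n ∧
      (((n - u.length) % L = 0 ∧ σ n = n + 1 ∧ (n + 1 - u.length) % L = 1) ∨
        ((n - u.length) % L = 1 ∧ σ n = n - 1 ∧ u.length ≤ n - 1 ∧ n - 1 + 1 = n ∧
          (n - 1 - u.length) % L = 0) ∨
        (2 ≤ (n - u.length) % L ∧ (n - u.length) % L < L ∧ σ n = n))) := by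
    intro n
    by_cases h : n < u.length
    · exact Or.inl ⟨h, if_pos h⟩
    · refine Or.inr ⟨by omega, ?_⟩
      obtain ⟨j, rfl⟩ : ∃ j, n = u.length + j := ⟨n - u.length, by omega⟩
      have hlt : j % L < L := Nat.mod_lt _ (by omega)
      simp only [σ, if_neg h, Nat.add_sub_cancel_left]
      by_cases h0 : j % L = 0
      · refine Or.inl ⟨h0, if_pos h0, ?_⟩
        rw [Nat.add_assoc, Nat.add_sub_cancel_left, Nat.add_mod, h0, Nat.zero_add, Nat.mod_mod,
          Nat.mod_eq_of_lt (by omega)]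
      · by_cases h1 : j % L = 1
        · refine Or.inr (Or.inl ⟨h1, by rw [if_neg h0, if_pos h1], ?_⟩)
          have hj : 1 ≤ j := by
            rcases j with _ | j
            · simp at h1
            · omega
          refine ⟨by omega, by omega, ?_⟩
          have e : u.length + j - 1 - u.length = j - 1 := by omega
          rw [e, Nat.sub_mod_eq_zero_of_mod_eq]
          rw [h1, Nat.mod_eq_of_lt (by omega)]
        · exact Or.inr (Or.inr ⟨by omega, hlt, by rw [if_neg h0, if_neg h1]⟩)
  have hσσ : ∀ n, σ (σ n) = n := by
    intro n
    rcases hcase n with ⟨-, h⟩ | ⟨hn, ⟨h1, h2, h3⟩ | ⟨h1, h2, h3, h4, h5⟩ | ⟨-, -, h⟩⟩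
    · rw [h, h]
    · rw [h2]
      simp only [σ]
      rw [if_neg (by omega), if_neg (by omega), if_pos h3]
      omega
    · rw [h2]
      simp only [σ]
      rw [if_neg (by omega), if_pos h5, h4]
    · rw [h, h]
  have hlab : ∀ n, lasso d u (b :: a :: s) (σ n) = lasso d u (a :: b :: s) n := by
    intro n
    have hlen : ∀ a b : α, (a :: b :: s).length = L := fun _ _ => rfl
    rcases hcase n with ⟨h', h⟩ | ⟨hn, ⟨h1, h2, h3⟩ | ⟨h1, h2, h3, h4, h5⟩ | ⟨h1, h2, h⟩⟩
    · rw [h, lasso, lasso, if_pos h', if_pos h']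
    · rw [h2, lasso, lasso, if_neg (by omega), if_neg (by omega), hlen, hlen, h1, h3]
      rfl
    · rw [h2, lasso, lasso, if_neg (by omega), if_neg (by omega), hlen, hlen, h1, h5]
      rfl
    · rw [h, lasso, lasso, if_neg (by omega), if_neg (by omega), hlen, hlen]
      obtain ⟨j, hj⟩ : ∃ j, (n - u.length) % L = j + 2 := ⟨_, (Nat.sub_add_cancel h1).symm⟩
      rw [hj]
      rfl
  refine ⟨⟨σ, σ, hσσ, hσσ⟩, hlab, fun (i : ℕ) (j : ℕ) => ?_⟩
  change (σ i < σ j ∧ ¬ I (lasso d u (b :: a :: s) (σ i)) (lasso d u (b :: a :: s) (σ j))) ↔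
    (i < j ∧ ¬ I (lasso d u (a :: b :: s) i) (lasso d u (a :: b :: s) j))
  rw [hlab, hlab]
  refine and_congr_left fun hd => ?_
  have hpair : ∀ n, u.length ≤ n → (n - u.length) % L = 0 → (n + 1 - u.length) % L = 1 →
      lasso d u (a :: b :: s) n = a ∧ lasso d u (a :: b :: s) (n + 1) = b := by
    intro n hn h0 h1
    have hlen : (a :: b :: s).length = L := rfl
    rw [lasso, lasso, if_neg (by omega), if_neg (by omega), hlen, h0, h1]
    exact ⟨rfl, rfl⟩
  have hij : ∀ i j, ¬ I (lasso d u (a :: b :: s) i) (lasso d u (a :: b :: s) j) →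
      ¬ (u.length ≤ i ∧ (i - u.length) % L = 0 ∧ (i + 1 - u.length) % L = 1 ∧ j = i + 1) ∧
      ¬ (u.length ≤ j ∧ (j - u.length) % L = 0 ∧ (j + 1 - u.length) % L = 1 ∧ i = j + 1) := by
    intro i j hd
    constructor
    · rintro ⟨h, h0, h1, rfl⟩
      rw [(hpair i h h0 h1).1, (hpair i h h0 h1).2] at hd
      exact hd hab
    · rintro ⟨h, h0, h1, rfl⟩
      rw [(hpair j h h0 h1).1, (hpair j h h0 h1).2] at hd
      exact hd hba
  have hmono : ∀ i j, i < j → ¬ (u.length ≤ i ∧ (i - u.length) % L = 0 ∧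
      (i + 1 - u.length) % L = 1 ∧ j = i + 1) → σ i < σ j := by
    intro i j hlt hne
    have hi := hcase i
    have hj := hcase j
    by_cases h1 : j = i + 1
    · subst h1
      simp only [Nat.add_sub_cancel] at hi hj
      omega
    by_cases h2 : j = i + 2
    · subst h2
      simp only [show i + 2 - 1 = i + 1 by omega] at hi hj
      omega
    omega
  have hij := hij i j hd
  constructor
  · intro h
    by_contra h'
    rcases Nat.lt_or_ge j i with h1 | h1
    · exact absurd (hmono j i h1 fun h => hij.2 h) (by omega)
    · have : i = j := by omega
      subst this
      omega
  · exact fun h => hmono i j h fun h => hij.1 h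

theorem not_omegaTraceClosed_of_hasUnstableSwap {α σ : Type*} {I : α → α → Prop}
    (hI : IsIndependence I) {M : DFA α σ} (hsurj : Function.Surjective M.eval)
    (hM : ∀ q a b, I a b → M.step (M.step q a) b = M.step (M.step q b) a)
    (hs : HasUnstableSwap I M) : ¬ OmegaTraceClosed I (limLanguage M.accepts) := by
  obtain ⟨p, a, b, hab, h1, h2, h3, h4, h5⟩ := hs
  obtain ⟨s, hs, hav⟩ := exists_runAvoids h4 h5
  obtain ⟨u, hu⟩ := hsurj p
  have hx : M.evalFrom p (a :: b :: s) = p := by simpa [hM _ _ _ hab] using hs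
  have hy : M.evalFrom p (b :: a :: s) = p := by simpa using hs
  have hyav : RunAvoids M p (b :: a :: s) := runAvoids_cons.mpr ⟨h2, runAvoids_cons.mpr ⟨h3, hav⟩⟩
  intro hcl
  have hmem := hcl _ _ (omegaTraceEquiv_lasso hI hab a u s) ?_
  · rw [mem_limLanguage_iff] at hmem
    obtain ⟨m, hm, hacc⟩ := hmem u.length
    obtain ⟨j, rfl⟩ := Nat.exists_eq_add_of_le hm
    rw [DFA.mem_accepts, eval_wordPrefix_lasso a (by simp) hu hy] at hacc
    exact hyav _ _ (List.take_append_drop _ _) hacc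
  · rw [mem_limLanguage_iff]
    intro N
    refine ⟨u.length + (N * (s.length + 2) + 1), ?_, ?_⟩
    · nlinarith [Nat.zero_le (N * s.length)]
    · rw [DFA.mem_accepts, eval_wordPrefix_lasso a (by simp) hu hx]
      have : (N * (s.length + 2) + 1) % (a :: b :: s).length = 1 := by
        change (N * (s.length + 2) + 1) % (s.length + 2) = 1
        rw [Nat.mul_add_mod_self_right, Nat.mod_eq_of_lt (by omega)]
      rw [this]
      simpa using h1

/-- The criterion that the algorithm checks. -/
theorem limitStable_iff {α : Type*} {n : ℕ} {I : α → α → Prop} (hI : IsIndependence I)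
    (T : Set (FiniteTrace I)) {M : DFA α (Fin n)} (hM : IsMinimalDFA M (linearizations T)) :
    LimitStable I (linearizations T) ↔ ¬ HasUnstableSwap I M := by
  have hT := traceClosed_linearizations T
  have hcomm : ∀ q a b, I a b → M.step (M.step q a) b = M.step (M.step q b) a :=
    fun q a b hab => hM.step_comm hI hT q hab
  have hsurj := hM.surjective_injective.1
  constructor
  · intro h hs
    refine not_omegaTraceClosed_of_hasUnstableSwap hI hsurj hcomm hs ?_
    rw [hM.1]
    exact h.2
  · intro h
    refine ⟨hT, ?_⟩
    rw [← hM.1]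
    exact omegaTraceClosed_of_not_hasUnstableSwap hI hcomm h

/-! ## Weakest preconditions -/

/-- The program terminates from `s` in a number of steps and a final state that satisfy `Q`. -/
def WP (W : ℕ) (P : RamProg) (s : RamState) (Q : ℕ → RamState → Prop) : Prop :=
  ∃ t s', RamExec W P s t s' ∧ Q t s'

section WP

variable {W : ℕ} {P P' : RamProg} {s : RamState} {Q : ℕ → RamState → Prop}

theorem wp_const {x c : ℕ} : WP W (.const x c) s Q ↔ c < W ∧ Q 1 (s.setReg x c) := by
  constructor
  · rintro ⟨t, s', h, hq⟩
    cases h with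
    | const _ _ _ h => exact ⟨h, hq⟩
  · rintro ⟨h, hq⟩
    exact ⟨_, _, .const s x c h, hq⟩

theorem wp_add {x y z : ℕ} : WP W (.add x y z) s Q ↔
    s.reg y + s.reg z < W ∧ Q 1 (s.setReg x (s.reg y + s.reg z)) := by
  constructor
  · rintro ⟨t, s', h, hq⟩
    cases h with
    | add _ _ _ _ h => exact ⟨h, hq⟩
  · rintro ⟨h, hq⟩
    exact ⟨_, _, .add s x y z h, hq⟩

theorem wp_mul {x y z : ℕ} : WP W (.mul x y z) s Q ↔
    s.reg y * s.reg z < W ∧ Q 1 (s.setReg x (s.reg y * s.reg z)) := by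
  constructor
  · rintro ⟨t, s', h, hq⟩
    cases h with
    | mul _ _ _ _ h => exact ⟨h, hq⟩
  · rintro ⟨h, hq⟩
    exact ⟨_, _, .mul s x y z h, hq⟩

theorem wp_skip : WP W .skip s Q ↔ Q 1 s := by
  constructor
  · rintro ⟨t, s', h, hq⟩
    cases h with
    | skip _ => exact hq
  · exact fun hq => ⟨_, _, .skip s, hq⟩

theorem wp_copy {x y : ℕ} : WP W (.copy x y) s Q ↔ Q 1 (s.setReg x (s.reg y)) := by
  constructor
  · rintro ⟨t, s', h, hq⟩
    cases h with
    | copy _ _ _ => exact hq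
  · exact fun hq => ⟨_, _, .copy s x y, hq⟩

theorem wp_load {x y : ℕ} : WP W (.load x y) s Q ↔ Q 1 (s.setReg x (s.mem (s.reg y))) := by
  constructor
  · rintro ⟨t, s', h, hq⟩
    cases h with
    | load _ _ _ => exact hq
  · exact fun hq => ⟨_, _, .load s x y, hq⟩

theorem wp_store {x y : ℕ} :
    WP W (.store x y) s Q ↔ Q 1 (s.setMem (s.reg x) (s.reg y)) := by
  constructor
  · rintro ⟨t, s', h, hq⟩
    cases h with
    | store _ _ _ => exact hq
  · exact fun hq => ⟨_, _, .store s x y, hq⟩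

theorem wp_seq : WP W (.seq P P') s Q ↔
    WP W P s (fun t s' => WP W P' s' (fun t' s'' => Q (t + t') s'')) := by
  constructor
  · rintro ⟨t, s', h, hq⟩
    cases h with
    | seq h h' => exact ⟨_, _, h, _, _, h', hq⟩
  · rintro ⟨t, s', h, t', s'', h', hq⟩
    exact ⟨_, _, .seq h h', hq⟩

theorem wp_branch {b : RamTest} : WP W (.branch b P P') s Q ↔
    (b.Holds s → WP W P s (fun t s' => Q (1 + t) s')) ∧
      (¬ b.Holds s → WP W P' s (fun t s' => Q (1 + t) s')) := by
  constructor
  · rintro ⟨t, s', h, hq⟩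
    cases h with
    | branchTrue hb h => exact ⟨fun _ => ⟨_, _, h, hq⟩, fun h => absurd hb h⟩
    | branchFalse hb h => exact ⟨fun h => absurd h hb, fun _ => ⟨_, _, h, hq⟩⟩
  · rintro ⟨h1, h2⟩
    by_cases hb : b.Holds s
    · obtain ⟨t, s', h, hq⟩ := h1 hb
      exact ⟨_, _, .branchTrue hb h, hq⟩
    · obtain ⟨t, s', h, hq⟩ := h2 hb
      exact ⟨_, _, .branchFalse hb h, hq⟩

/-- A loop with an invariant that is indexed by the number of completed rounds, of which there are
at most `N`. -/
theorem wp_loop {b : RamTest} (Inv : ℕ → RamState → Prop) (N T : ℕ) (h0 : Inv 0 s)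
    (hstep : ∀ j s, Inv j s → b.Holds s →
      j < N ∧ WP W P s (fun t s' => t ≤ T ∧ Inv (j + 1) s'))
    (hQ : ∀ t s' j, t ≤ N * (T + 1) + 1 → Inv j s' → ¬ b.Holds s' → Q t s') :
    WP W (.loop b P) s Q := by
  have key : ∀ m j s, N - j = m → Inv j s →
      ∃ t s', RamExec W (.loop b P) s t s' ∧ t ≤ m * (T + 1) + 1 ∧ ∃ j', Inv j' s' ∧
        ¬ b.Holds s' := by
    intro m
    induction m with
    | zero =>
      intro j s hj hs
      have hb : ¬ b.Holds s := fun hb => by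
        have := (hstep j s hs hb).1
        omega
      exact ⟨1, s, .loopFalse hb, by omega, j, hs, hb⟩
    | succ m ih =>
      intro j s hj hs
      by_cases hb : b.Holds s
      · obtain ⟨hlt, t, s', hex, ht, hs'⟩ := hstep j s hs hb
        obtain ⟨t', s'', hex', ht', h⟩ := ih (j + 1) s' (by omega) hs'
        refine ⟨_, s'', .loopTrue hb hex hex', ?_, h⟩
        rw [Nat.succ_mul]
        omega
      · exact ⟨1, s, .loopFalse hb, by omega, j, hs, hb⟩
  obtain ⟨t, s', hex, ht, j', hs', hb⟩ := key (N - 0) 0 s rfl h0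
  exact ⟨t, s', hex, hQ t s' j' ht hs' hb⟩

/-- A counting loop. -/
theorem wp_for {x y : ℕ} (Inv : ℕ → RamState → Prop) (N T : ℕ)
    (hN : ∀ j s, Inv j s → s.reg x = j ∧ s.reg y = N ∧ j ≤ N) (h0 : Inv 0 s)
    (hstep : ∀ j s, j < N → Inv j s → WP W P s (fun t s' => t ≤ T ∧ Inv (j + 1) s'))
    (hQ : ∀ t s', t ≤ N * (T + 1) + 1 → Inv N s' → Q t s') :
    WP W (.loop (.lt x y) P) s Q := by
  refine wp_loop Inv N T h0 ?_ ?_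
  · intro j s hs hb
    obtain ⟨h1, h2, -⟩ := hN j s hs
    have hlt : j < N := by
      rw [← h1, ← h2]
      exact hb
    exact ⟨hlt, hstep j s hlt hs⟩
  · intro t s' j ht hs hb
    obtain ⟨h1, h2, h3⟩ := hN j s' hs
    have : ¬ j < N := by
      rw [← h1, ← h2]
      exact hb
    obtain rfl : j = N := by omega
    exact hQ t s' ht hs

end WP

theorem RamState.reg_setReg (s : RamState) (x v y : ℕ) :
    (s.setReg x v).reg y = if y = x then v else s.reg y := by
  simp [RamState.setReg, Function.update_apply]

theorem RamState.mem_setReg (s : RamState) (x v : ℕ) : (s.setReg x v).mem = s.mem := rfl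

theorem RamState.reg_setMem (s : RamState) (i v : ℕ) : (s.setMem i v).reg = s.reg := rfl

theorem RamState.mem_setMem (s : RamState) (i v j : ℕ) :
    (s.setMem i v).mem j = if j = i then v else s.mem j := by
  simp [RamState.setMem, Function.update_apply]

/-! ## The program -/

/-- Sequential composition of a list of programs. -/
def RamProg.block : List RamProg → RamProg
  | [] => .skip
  | p :: ps => .seq p (block ps)

theorem wp_block_nil {W : ℕ} {s : RamState} {Q : ℕ → RamState → Prop} :
    WP W (.block []) s Q ↔ Q 1 s := wp_skip

theorem wp_block_cons {W : ℕ} {p : RamProg} {ps : List RamProg} {s : RamState}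
    {Q : ℕ → RamState → Prop} : WP W (.block (p :: ps)) s Q ↔
      WP W p s (fun t s' => WP W (.block ps) s' (fun t' s'' => Q (t + t') s'')) := wp_seq

/-- Computes the constants: `R1 = 1`, `R2 = n`, `R3 = k`, and the base addresses of the final
states, the transition table, the independence relation, the marks, and the two components of the
queue in `R4`, …, `R9`. Register `R10` stays 0. -/
def setupProg : RamProg := .block [
  .const 1 1, .load 2 10, .load 3 1, .const 4 3, .add 5 4 2, .mul 6 2 3, .add 6 5 6,
  .mul 7 3 3, .add 7 6 7, .mul 11 2 2, .add 8 7 11, .add 9 8 11, .const 11 0]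

/-- Marks the pair `(R13, R17)` and appends it to the queue, which has `R11` elements, if it is
unmarked and `R17` is a nonfinal state. -/
def visitProg : RamProg := .block [
  .add 16 4 17, .load 18 16,
  .branch (.eq 18 10) (.block [
    .mul 16 13 2, .add 16 16 17, .add 16 7 16, .load 18 16,
    .branch (.eq 18 10) (.block [
      .store 16 1, .add 16 8 11, .store 16 13, .add 16 9 11, .store 16 17, .add 11 11 1])
      .skip]) .skip]

/-- Visits all pairs `(q, q)`. -/
def seedProg : RamProg :=
  .loop (.lt 13 2) (.block [.copy 17 13, visitProg, .add 13 13 1])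

/-- Visits the pairs `(r, q')` for all successors `q'` of `q`, where `(r, q)` is the queue element
at position `R12`. -/
def expandProg : RamProg := .block [
  .add 16 8 12, .load 13 16, .add 16 9 12, .load 14 16, .const 15 0,
  .loop (.lt 15 3) (.block [
    .mul 16 14 3, .add 16 16 15, .add 16 5 16, .load 17 16, visitProg, .add 15 15 1]),
  .add 12 12 1]

/-- Processes the whole queue. -/
def closeProg : RamProg := .loop (.lt 12 11) expandProg

/-- Sets `R0` to 0 if the state `R13` and the letters `R14` and `R15` form a violation. -/
def checkProg : RamProg := .block [
  .mul 16 14 3, .add 16 16 15, .add 16 6 16, .load 18 16,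
  .branch (.eq 18 1) (.block [
    .mul 16 13 3, .add 16 16 14, .add 16 5 16, .load 18 16, .add 16 4 18, .load 18 16,
    .branch (.eq 18 1) (.block [
      .mul 16 13 3, .add 16 16 15, .add 16 5 16, .load 17 16, .add 16 4 17, .load 18 16,
      .branch (.eq 18 10) (.block [
        .mul 16 17 3, .add 16 16 14, .add 16 5 16, .load 17 16,
        .mul 16 17 2, .add 16 16 13, .add 16 7 16, .load 18 16,
        .branch (.eq 18 1) (.const 0 0) .skip]) .skip]) .skip]) .skip]

/-- Checks all states and all pairs of letters. -/
def searchProg : RamProg := .block [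
  .const 0 1, .const 13 0,
  .loop (.lt 13 2) (.block [
    .const 14 0,
    .loop (.lt 14 3) (.block [
      .const 15 0,
      .loop (.lt 15 3) (.block [checkProg, .add 15 15 1]),
      .add 14 14 1]),
    .add 13 13 1])]

/-- The decision procedure for limit-stability. -/
def limitStableProg : RamProg := .block [setupProg, seedProg, closeProg, searchProg]

/-! ## Correctness of the program -/

/-- A step into a nonfinal state, in terms of the tables. -/
def TableStep (k : ℕ) (f : ℕ → ℕ) (d : ℕ → ℕ → ℕ) (q q' : ℕ) : Prop :=
  f q' = 0 ∧ ∃ a < k, d q a = q'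

/-- `p.2` is reachable from `p.1` through nonfinal states. -/
def TableReach (k : ℕ) (f : ℕ → ℕ) (d : ℕ → ℕ → ℕ) (p : ℕ × ℕ) : Prop :=
  f p.1 = 0 ∧ ReflTransGen (TableStep k f d) p.1 p.2

/-- The constant registers and the input in memory. -/
structure Layout (n k : ℕ) (f : ℕ → ℕ) (d g : ℕ → ℕ → ℕ) (s : RamState) : Prop where
  reg1 : s.reg 1 = 1
  reg2 : s.reg 2 = n
  reg3 : s.reg 3 = k
  reg4 : s.reg 4 = 3
  reg5 : s.reg 5 = 3 + n
  reg6 : s.reg 6 = 3 + n + n * k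
  reg7 : s.reg 7 = 3 + n + n * k + k * k
  reg8 : s.reg 8 = 3 + n + n * k + k * k + n * n
  reg9 : s.reg 9 = 3 + n + n * k + k * k + n * n + n * n
  reg10 : s.reg 10 = 0
  final : ∀ q < n, s.mem (3 + q) = f q
  step : ∀ q < n, ∀ a < k, s.mem (3 + n + (q * k + a)) = d q a
  indep : ∀ a < k, ∀ b < k, s.mem (3 + n + n * k + (a * k + b)) = g a b

/-- The queue holds `qs`, and exactly its elements are marked. -/
structure Marked (n k : ℕ) (f : ℕ → ℕ) (d g : ℕ → ℕ → ℕ) (qs : List (ℕ × ℕ)) (s : RamState) :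
    Prop where
  layout : Layout n k f d g s
  tail : s.reg 11 = qs.length
  lt : ∀ p ∈ qs, p.1 < n ∧ p.2 < n
  nodup : qs.Nodup
  queue : ∀ i p, qs[i]? = some p →
    s.mem (3 + n + n * k + k * k + n * n + i) = p.1 ∧
      s.mem (3 + n + n * k + k * k + n * n + n * n + i) = p.2
  mark : ∀ r < n, ∀ q < n,
    s.mem (3 + n + n * k + k * k + (r * n + q)) = if (r, q) ∈ qs then 1 else 0
  sound : ∀ p ∈ qs, TableReach k f d p

theorem mul_add_lt_mul {a b m n : ℕ} (ha : a < m) (hb : b < n) : a * n + b < m * n := by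
  have := Nat.mul_le_mul_right n (Nat.succ_le_of_lt ha)
  rw [Nat.succ_mul] at this
  omega

theorem mul_add_inj {a b a' b' n : ℕ} (hb : b < n) (hb' : b' < n) :
    a * n + b = a' * n + b' ↔ a = a' ∧ b = b' := by
  constructor
  · intro h
    have h1 := congrArg (· / n) h
    have h2 := congrArg (· % n) h
    have hn : 0 < n := by omega
    simp only [Nat.mul_add_mod_self_right, Nat.mod_eq_of_lt hb, Nat.mod_eq_of_lt hb'] at h2
    simp only [Nat.mul_comm _ n, Nat.mul_add_div hn, Nat.div_eq_of_lt hb,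
      Nat.div_eq_of_lt hb', Nat.add_zero] at h1
    exact ⟨h1, h2⟩
  · rintro ⟨rfl, rfl⟩
    rfl

section Correctness

variable {W n k : ℕ} {f : ℕ → ℕ} {d g : ℕ → ℕ → ℕ} {qs : List (ℕ × ℕ)} {s s' : RamState}

theorem Layout.congr (h : Layout n k f d g s) (hreg : ∀ x, 1 ≤ x → x ≤ 10 → s'.reg x = s.reg x)
    (hmem : ∀ i, i < 3 + n + n * k + k * k → s'.mem i = s.mem i) : Layout n k f d g s' where
  reg1 := (hreg _ (by omega) (by omega)).trans h.reg1
  reg2 := (hreg _ (by omega) (by omega)).trans h.reg2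
  reg3 := (hreg _ (by omega) (by omega)).trans h.reg3
  reg4 := (hreg _ (by omega) (by omega)).trans h.reg4
  reg5 := (hreg _ (by omega) (by omega)).trans h.reg5
  reg6 := (hreg _ (by omega) (by omega)).trans h.reg6
  reg7 := (hreg _ (by omega) (by omega)).trans h.reg7
  reg8 := (hreg _ (by omega) (by omega)).trans h.reg8
  reg9 := (hreg _ (by omega) (by omega)).trans h.reg9
  reg10 := (hreg _ (by omega) (by omega)).trans h.reg10
  final q hq := (hmem _ (by omega)).trans (h.final q hq)
  step q hq a ha := (hmem _ (by have := mul_add_lt_mul hq ha; omega)).trans (h.step q hq a ha)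
  indep a ha b hb := (hmem _ (by have := mul_add_lt_mul ha hb; omega)).trans (h.indep a ha b hb)

theorem Marked.congr (h : Marked n k f d g qs s) (hreg : ∀ x, 1 ≤ x → x ≤ 11 → s'.reg x = s.reg x)
    (hmem : s'.mem = s.mem) : Marked n k f d g qs s' where
  layout := h.layout.congr (fun x h1 h2 => hreg x h1 (by omega)) (fun i _ => by rw [hmem])
  tail := (hreg 11 (by omega) (by omega)).trans h.tail
  lt := h.lt
  nodup := h.nodup
  queue := by rw [hmem]; exact h.queue
  mark := by rw [hmem]; exact h.mark
  sound := h.sound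

theorem Marked.length_le (h : Marked n k f d g qs s) : qs.length ≤ n * n := by
  have hsub : qs.toFinset ⊆ Finset.range n ×ˢ Finset.range n := by
    intro p hp
    have := h.lt p (List.mem_toFinset.mp hp)
    simpa using this
  have := Finset.card_le_card hsub
  rwa [List.toFinset_card_of_nodup h.nodup, Finset.card_product, Finset.card_range] at this

theorem Marked.length_lt (h : Marked n k f d g qs s) {p : ℕ × ℕ} (h1 : p.1 < n) (h2 : p.2 < n)
    (hp : p ∉ qs) : qs.length < n * n := by
  have hsub : (p :: qs).toFinset ⊆ Finset.range n ×ˢ Finset.range n := by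
    intro p' hp'
    rcases List.mem_cons.mp (List.mem_toFinset.mp hp') with rfl | hp'
    · simpa using ⟨h1, h2⟩
    · simpa using h.lt p' hp'
  have := Finset.card_le_card hsub
  rw [List.toFinset_card_of_nodup (List.nodup_cons.mpr ⟨hp, h.nodup⟩), Finset.card_product,
    Finset.card_range, List.length_cons] at this
  omega

/-- Appending an unmarked pair to the queue. -/
theorem Marked.push (h : Marked n k f d g qs s) {r q : ℕ} (hr : r < n) (hq : q < n)
    (hp : (r, q) ∉ qs) (hs : TableReach k f d (r, q))
    (hreg : ∀ x, 1 ≤ x → x ≤ 10 → s'.reg x = s.reg x) (htail : s'.reg 11 = qs.length + 1)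
    (hmem : ∀ i, s'.mem i =
      if i = 3 + n + n * k + k * k + n * n + n * n + qs.length then q else
      if i = 3 + n + n * k + k * k + n * n + qs.length then r else
      if i = 3 + n + n * k + k * k + (r * n + q) then 1 else s.mem i) :
    Marked n k f d g (qs ++ [(r, q)]) s' := by
  have hlen := h.length_lt (p := (r, q)) hr hq hp
  have hrq := mul_add_lt_mul hr hq
  refine ⟨h.layout.congr hreg ?_, by simpa using htail, ?_, ?_, ?_, ?_, ?_⟩
  · intro i hi
    rw [hmem, if_neg (by omega), if_neg (by omega), if_neg (by omega)]
  · intro p hp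
    rcases List.mem_append.mp hp with hp | hp
    · exact h.lt p hp
    · rw [List.mem_singleton.mp hp]
      exact ⟨hr, hq⟩
  · exact List.nodup_append.mpr ⟨h.nodup, by simp, by
      intro a ha b hb hab
      rw [List.mem_singleton.mp hb] at hab
      exact hp (hab ▸ ha)⟩
  · intro i p hi
    rcases Nat.lt_trichotomy i qs.length with hlt | rfl | hgt
    · rw [List.getElem?_append_left hlt] at hi
      have := h.queue i p hi
      rw [hmem, hmem, if_neg (by omega), if_neg (by omega), if_neg (by omega), if_neg (by omega),
        if_neg (by omega), if_neg (by omega)]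
      exact this
    · rw [List.getElem?_concat_length] at hi
      obtain rfl := Option.some.inj hi
      rw [hmem, hmem, if_neg (by omega), if_pos rfl, if_pos rfl]
      exact ⟨rfl, rfl⟩
    · rw [List.getElem?_eq_none (by simp; omega)] at hi
      exact absurd hi (by simp)
  · intro r' hr' q' hq'
    have hrq' := mul_add_lt_mul hr' hq'
    rw [hmem, if_neg (by omega), if_neg (by omega)]
    have e : (3 + n + n * k + k * k + (r' * n + q') = 3 + n + n * k + k * k + (r * n + q)) ↔
        r' = r ∧ q' = q := by
      rw [← mul_add_inj hq' hq]
      omega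
    simp only [e, List.mem_append, List.mem_singleton, Prod.mk.injEq]
    by_cases hc : r' = r ∧ q' = q
    · rw [if_pos hc, if_pos (Or.inr hc)]
    · rw [if_neg hc, h.mark r' hr' q' hq']
      simp only [hc, or_false]
  · intro p hp
    rcases List.mem_append.mp hp with hp | hp
    · exact h.sound p hp
    · rw [List.mem_singleton.mp hp]
      exact hs

theorem wp_visitProg (hW : 3 + n + n * k + k * k + n * n + n * n + n * n + 4 ≤ W)
    (h : Marked n k f d g qs s) {r q : ℕ} (hr : s.reg 13 = r) (hq : s.reg 17 = q) (hrn : r < n)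
    (hqn : q < n) (hs : f q = 0 → TableReach k f d (r, q)) {Q : ℕ → RamState → Prop}
    (hQ : ∀ t s' qs', t ≤ 20 → Marked n k f d g qs' s' → qs <+: qs' →
      (f q = 0 → (r, q) ∈ qs') → (∀ x, 12 ≤ x → x ≤ 15 → s'.reg x = s.reg x) → Q t s') :
    WP W visitProg s Q := by
  have hrq := mul_add_lt_mul hrn hqn
  have hl := h.layout
  have hrn' : r * n < W := by omega
  simp only [visitProg, wp_block_cons, wp_block_nil, wp_add, wp_load, wp_branch, wp_mul, wp_store,
    wp_skip, RamTest.Holds, RamState.reg_setReg, RamState.mem_setReg, RamState.reg_setMem,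
    hl.reg1, hl.reg2, hl.reg4, hl.reg7, hl.reg8, hl.reg9, hl.reg10, hr, hq, h.tail,
    hl.final q hqn, h.mark r hrn q hqn, reduceIte,
    Nat.reduceEqDiff]
  have hlen := h.length_le
  refine ⟨by omega, fun hf => ⟨hrn', by omega, by omega, fun hm => ?_, fun hm => ?_⟩, fun hf => ?_⟩
  · have hp : (r, q) ∉ qs := by
      intro hp
      simp [hp] at hm
    refine ⟨by omega, by omega, by omega, ?_⟩
    refine hQ _ _ (qs ++ [(r, q)]) (by omega) (h.push hrn hqn hp (hs hf) ?_ ?_ ?_)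
      (List.prefix_append _ _) (fun _ => by simp) ?_
    · intro x h1 h2
      simp only [RamState.reg_setReg, RamState.reg_setMem]
      rw [if_neg (by omega), if_neg (by omega), if_neg (by omega), if_neg (by omega),
        if_neg (by omega), if_neg (by omega), if_neg (by omega), if_neg (by omega),
        if_neg (by omega)]
    · simp [RamState.reg_setReg]
    · intro i
      simp only [RamState.mem_setReg, RamState.mem_setMem]
    · intro x h1 h2
      simp only [RamState.reg_setReg, RamState.reg_setMem]
      rw [if_neg (by omega), if_neg (by omega), if_neg (by omega), if_neg (by omega),
        if_neg (by omega), if_neg (by omega), if_neg (by omega), if_neg (by omega),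
        if_neg (by omega)]
  · have hp : (r, q) ∈ qs := by
      by_contra hp
      simp [hp] at hm
    refine hQ _ _ qs (by omega) (h.congr ?_ rfl) (List.prefix_refl _) (fun _ => hp) ?_
    · intro x h1 h2
      simp only [RamState.reg_setReg]
      rw [if_neg (by omega), if_neg (by omega), if_neg (by omega), if_neg (by omega),
        if_neg (by omega), if_neg (by omega)]
    · intro x h1 h2
      simp only [RamState.reg_setReg]
      rw [if_neg (by omega), if_neg (by omega), if_neg (by omega), if_neg (by omega),
        if_neg (by omega), if_neg (by omega)]
  · refine hQ _ _ qs (by omega) (h.congr ?_ rfl) (List.prefix_refl _) (fun h => absurd h hf) ?_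
    · intro x h1 h2
      simp only [RamState.reg_setReg]
      rw [if_neg (by omega), if_neg (by omega)]
    · intro x h1 h2
      simp only [RamState.reg_setReg]
      rw [if_neg (by omega), if_neg (by omega)]

theorem wp_seedProg (hW : 3 + n + n * k + k * k + n * n + n * n + n * n + 4 ≤ W)
    (h : Marked n k f d g [] s) (h12 : s.reg 12 = 0) (h13 : s.reg 13 = 0)
    {Q : ℕ → RamState → Prop}
    (hQ : ∀ t s' qs, t ≤ n * 30 + 1 → Marked n k f d g qs s' → s'.reg 12 = 0 →
      (∀ r < n, f r = 0 → (r, r) ∈ qs) → Q t s') : WP W seedProg s Q := by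
  refine wp_for (fun j s => s.reg 13 = j ∧ j ≤ n ∧ s.reg 12 = 0 ∧
    ∃ qs, Marked n k f d g qs s ∧ ∀ r < j, f r = 0 → (r, r) ∈ qs) n 29 ?_ ?_ ?_ ?_
  · rintro j s ⟨h1, h2, -, qs, h3, -⟩
    exact ⟨h1, h3.layout.reg2, h2⟩
  · exact ⟨h13, Nat.zero_le _, h12, [], h, by simp⟩
  · rintro j s hj ⟨h1, h2, h3, qs, h4, h5⟩
    simp only [wp_block_cons, wp_copy]
    refine wp_visitProg (f := f) (d := d) (g := g) hW (r := j) (q := j) (qs := qs) ?_ ?_ ?_ hj hj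
      (fun hf => ⟨hf, ReflTransGen.refl⟩) ?_
    · refine h4.congr (fun x hx hx' => ?_) rfl
      rw [RamState.reg_setReg, if_neg (by omega)]
    · simpa [RamState.reg_setReg] using h1
    · simpa [RamState.reg_setReg] using h1
    · intro t s' qs' ht hm hpre hin hreg
      have hreg' : ∀ x, 12 ≤ x → x ≤ 15 → s'.reg x = s.reg x := fun x hx hx' => by
        rw [hreg x hx hx', RamState.reg_setReg, if_neg (by omega)]
      simp only [wp_add, wp_block_nil, hreg' 13 (by omega) (by omega), h1, hm.layout.reg1]
      have hn := Nat.le_mul_self n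
      refine ⟨by omega, by omega, by simp [RamState.reg_setReg], hj, ?_, qs', hm.congr ?_ rfl, ?_⟩
      · simp [RamState.reg_setReg, hreg', h3]
      · intro x hx hx'
        rw [RamState.reg_setReg, if_neg (by omega)]
      · intro r hr hf
        rcases Nat.lt_succ_iff_lt_or_eq.mp hr with hr | rfl
        · exact hpre.subset (h5 r hr hf)
        · exact hin hf
  · rintro t s' ht ⟨h1, h2, h3, qs, h4, h5⟩
    exact hQ t s' qs ht h4 h3 h5

theorem wp_expandProg (hW : 3 + n + n * k + k * k + n * n + n * n + n * n + 4 ≤ W)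
    (hd : ∀ q < n, ∀ a < k, d q a < n)
    (h : Marked n k f d g qs s) {p : ℕ × ℕ} {i : ℕ} (hp : qs[i]? = some p) (h12 : s.reg 12 = i)
    {Q : ℕ → RamState → Prop}
    (hQ : ∀ t s' qs', t ≤ k * 30 + 10 → Marked n k f d g qs' s' → s'.reg 12 = i + 1 → qs <+: qs' →
      (∀ a < k, f (d p.2 a) = 0 → (p.1, d p.2 a) ∈ qs') → Q t s') : WP W expandProg s Q := by
  have hi : i < qs.length := (List.getElem?_eq_some_iff.mp hp).1
  have hlen := h.length_le
  obtain ⟨hp1, hp2⟩ := h.lt p (List.mem_of_getElem? hp)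
  have hsound := h.sound p (List.mem_of_getElem? hp)
  have hl := h.layout
  have hqueue := h.queue i p hp
  simp only [expandProg, wp_block_cons, wp_block_nil, wp_add, wp_load, wp_const,
    RamState.reg_setReg, RamState.mem_setReg, hl.reg8, hl.reg9, h12, hqueue.1, hqueue.2,
    Nat.reduceEqDiff, reduceIte]
  refine ⟨by omega, by omega, by omega, ?_⟩
  refine wp_for (fun j s => s.reg 15 = j ∧ j ≤ k ∧ s.reg 12 = i ∧ s.reg 13 = p.1 ∧ s.reg 14 = p.2 ∧
    ∃ qs', Marked n k f d g qs' s ∧ qs <+: qs' ∧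
      ∀ a < j, f (d p.2 a) = 0 → (p.1, d p.2 a) ∈ qs') k 29 ?_ ?_ ?_ ?_
  · rintro j s ⟨h1, h2, -, -, -, qs', h3, -⟩
    exact ⟨h1, h3.layout.reg3, h2⟩
  · refine ⟨by simp [RamState.reg_setReg], Nat.zero_le _, by simp [RamState.reg_setReg, h12],
      by simp [RamState.reg_setReg], by simp [RamState.reg_setReg], qs, h.congr ?_ rfl,
      List.prefix_refl _, by simp⟩
    intro x hx hx'
    simp only [RamState.reg_setReg]
    repeat rw [if_neg (by omega)]
  · rintro j s hj ⟨h1, h2, h3, h4, h5, qs', hm, hpre, hin⟩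
    have hl := hm.layout
    have hpj := mul_add_lt_mul hp2 hj
    simp only [wp_block_cons, wp_mul, wp_add, wp_load, RamState.reg_setReg, RamState.mem_setReg,
      hl.reg3, hl.reg5, h1, h5, Nat.reduceEqDiff, reduceIte, hl.step _ hp2 _ hj]
    refine ⟨by omega, by omega, by omega, ?_⟩
    refine wp_visitProg (f := f) (d := d) (g := g) hW (r := p.1) (q := d p.2 j) (qs := qs')
      ?_ ?_ ?_ hp1
      (hd _ hp2 _ hj) (fun hf => ⟨hsound.1, hsound.2.tail ⟨hf, j, hj, rfl⟩⟩) ?_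
    · refine hm.congr (fun x hx hx' => ?_) rfl
      simp only [RamState.reg_setReg]
      repeat rw [if_neg (by omega)]
    · simpa [RamState.reg_setReg] using h4
    · simp [RamState.reg_setReg]
    · intro t s' qs'' ht hm' hpre' hin' hreg
      have hreg' : ∀ x, 12 ≤ x → x ≤ 15 → s'.reg x = s.reg x := fun x hx hx' => by
        rw [hreg x hx hx']
        simp only [RamState.reg_setReg]
        repeat rw [if_neg (by omega)]
      simp only [wp_block_nil, hreg' 15 (by omega) (by omega), h1, hm'.layout.reg1]
      have hk := Nat.le_mul_self k
      refine ⟨by omega, by omega, by simp [RamState.reg_setReg], hj, ?_, ?_, ?_, qs'',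
        hm'.congr ?_ rfl, hpre.trans hpre', ?_⟩
      · simp [RamState.reg_setReg, hreg', h3]
      · simp [RamState.reg_setReg, hreg', h4]
      · simp [RamState.reg_setReg, hreg', h5]
      · intro x hx hx'
        rw [RamState.reg_setReg, if_neg (by omega)]
      · intro a ha hf
        rcases Nat.lt_succ_iff_lt_or_eq.mp ha with ha | rfl
        · exact hpre'.subset (hin a ha hf)
        · exact hin' hf
  · rintro t s' ht ⟨h1, h2, h3, h4, h5, qs', hm, hpre, hin⟩
    simp only [h3, hm.layout.reg1]
    refine ⟨by omega, ?_⟩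
    refine hQ _ _ qs' (by omega) (hm.congr ?_ rfl) (by simp [RamState.reg_setReg]) hpre hin
    intro x hx hx'
    rw [RamState.reg_setReg, if_neg (by omega)]

theorem wp_closeProg (hW : 3 + n + n * k + k * k + n * n + n * n + n * n + 4 ≤ W)
    (hd : ∀ q < n, ∀ a < k, d q a < n)
    (h : Marked n k f d g qs s) (h12 : s.reg 12 = 0) (hseed : ∀ r < n, f r = 0 → (r, r) ∈ qs)
    {Q : ℕ → RamState → Prop}
    (hQ : ∀ t s' qs', t ≤ n * n * (k * 30 + 11) + 1 → Marked n k f d g qs' s' →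
      (∀ r < n, ∀ q, (r, q) ∈ qs' ↔ TableReach k f d (r, q)) → Q t s') :
    WP W closeProg s Q := by
  refine wp_loop (fun j s => s.reg 12 = j ∧ ∃ qs, Marked n k f d g qs s ∧ j ≤ qs.length ∧
    (∀ r < n, f r = 0 → (r, r) ∈ qs) ∧ ∀ i < j, ∀ p, qs[i]? = some p → ∀ a < k,
      f (d p.2 a) = 0 → (p.1, d p.2 a) ∈ qs) (n * n) (k * 30 + 10) ?_ ?_ ?_
  · exact ⟨h12, qs, h, Nat.zero_le _, hseed, by simp⟩
  · rintro j s ⟨h1, qs, hm, hle, hs, hc⟩ hb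
    have hlt : j < qs.length := by
      have : s.reg 12 < s.reg 11 := hb
      rwa [h1, hm.tail] at this
    refine ⟨hlt.trans_le hm.length_le, ?_⟩
    have hp := List.getElem?_eq_getElem hlt
    refine wp_expandProg hW hd hm hp h1 fun t s' qs' ht hm' h1' hpre hin => ⟨ht, h1', qs', hm', ?_,
      fun r hr hf => hpre.subset (hs r hr hf), ?_⟩
    · exact Nat.lt_of_lt_of_le hlt hpre.length_le
    · intro i hi p hip a ha hf
      have hil : i < qs.length := by omega
      have hip' : qs[i]? = some p := by
        obtain ⟨l, rfl⟩ := hpre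
        rwa [List.getElem?_append_left hil] at hip
      clear hip
      rename' hip' => hip
      rcases Nat.lt_succ_iff_lt_or_eq.mp hi with hi | rfl
      · exact hpre.subset (hc i hi p hip a ha hf)
      · rw [hp] at hip
        obtain rfl := Option.some.inj hip
        exact hin a ha hf
  · rintro t s' j ht ⟨h1, qs, hm, hle, hs, hc⟩ hb
    have hj : j = qs.length := by
      have : ¬ s'.reg 12 < s'.reg 11 := hb
      rw [h1, hm.tail] at this
      omega
    refine hQ t s' qs ht hm fun r hr q => ⟨hm.sound _, ?_⟩
    rintro ⟨hf, hreach⟩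
    change f r = 0 at hf
    change ReflTransGen _ r q at hreach
    induction hreach with
    | refl => exact hs r hr hf
    | tail _ hstep ih =>
      obtain ⟨hf', a, ha, rfl⟩ := hstep
      obtain ⟨i, hi, hip⟩ := List.mem_iff_getElem.mp ih
      exact hc i (by omega) _ (List.getElem?_eq_some_iff.mpr ⟨hi, hip⟩) a ha hf'

/-- A violation of the criterion, in terms of the tables. -/
def TableViolation (k : ℕ) (f : ℕ → ℕ) (d g : ℕ → ℕ → ℕ) (p a b : ℕ) : Prop :=
  g a b = 1 ∧ f (d p a) = 1 ∧ f (d p b) = 0 ∧ TableReach k f d (d (d p b) a, p)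

theorem wp_checkProg (hW : 3 + n + n * k + k * k + n * n + n * n + n * n + 4 ≤ W)
    (hd : ∀ q < n, ∀ a < k, d q a < n) (h : Marked n k f d g qs s)
    (hqs : ∀ r < n, ∀ q, (r, q) ∈ qs ↔ TableReach k f d (r, q)) {p a b : ℕ} (hp : p < n)
    (ha : a < k) (hb : b < k) (h13 : s.reg 13 = p) (h14 : s.reg 14 = a) (h15 : s.reg 15 = b)
    {A : Prop} (h0 : s.reg 0 = truthBit A) {Q : ℕ → RamState → Prop}
    (hQ : ∀ t s', t ≤ 50 → Marked n k f d g qs s' →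
      (∀ x, 12 ≤ x → x ≤ 15 → s'.reg x = s.reg x) →
      s'.reg 0 = truthBit (A ∧ ¬ TableViolation k f d g p a b) → Q t s') :
    WP W checkProg s Q := by
  have hl := h.layout
  have hab := mul_add_lt_mul ha hb
  have hpa := mul_add_lt_mul hp ha
  have hpb := mul_add_lt_mul hp hb
  have hda := hd p hp a ha
  have hdb := hd p hp b hb
  have hdba := hd _ hdb a ha
  have hpba := mul_add_lt_mul hdb ha
  have hmark := mul_add_lt_mul hdba hp
  simp only [checkProg, wp_block_cons, wp_block_nil, wp_add, wp_load, wp_branch, wp_mul, wp_const,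
    wp_skip, RamTest.Holds, RamState.reg_setReg, RamState.mem_setReg,
    hl.reg1, hl.reg2, hl.reg3, hl.reg4, hl.reg5, hl.reg6, hl.reg7, hl.reg10, h13, h14, h15,
    hl.indep a ha b hb, hl.step p hp a ha, hl.step p hp b hb, hl.step _ hdb a ha,
    hl.final _ hda, hl.final _ hdb, h.mark _ hdba p hp, reduceIte, Nat.reduceEqDiff]
  have hno : ¬ TableViolation k f d g p a b →
      s.reg 0 = truthBit (A ∧ ¬ TableViolation k f d g p a b) := by
    intro hv
    rw [h0]
    congr 1
    simp [hv]
  refine ⟨by omega, by omega, by omega, fun h1 => ⟨by omega, by omega, by omega, by omega,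
    fun h2 => ⟨by omega, by omega, by omega, by omega, fun h3 => ⟨by omega, by omega, by omega,
    by omega, by omega, by omega, fun h4 => ⟨by omega, ?_⟩, fun h4 => ?_⟩, fun h3 => ?_⟩,
    fun h2 => ?_⟩, fun h1 => ?_⟩
  · have hin : (d (d p b) a, p) ∈ qs := by
      by_contra hin
      simp [hin] at h4
    refine hQ _ _ (by omega) (h.congr ?_ rfl) ?_ ?_
    · intro x hx hx'
      simp only [RamState.reg_setReg]
      repeat rw [if_neg (by omega)]
    · intro x hx hx'
      simp only [RamState.reg_setReg]
      repeat rw [if_neg (by omega)]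
    · have hv : TableViolation k f d g p a b := ⟨h1, h2, h3, (hqs _ hdba p).mp hin⟩
      simp [RamState.reg_setReg, truthBit, hv]
  all_goals
    refine hQ _ _ (by omega) (h.congr ?_ rfl) ?_ ?_
    · intro x hx hx'
      simp only [RamState.reg_setReg]
      repeat rw [if_neg (by omega)]
    · intro x hx hx'
      simp only [RamState.reg_setReg]
      repeat rw [if_neg (by omega)]
    · simp only [RamState.reg_setReg]
      repeat rw [if_neg (by omega)]
      refine hno fun hv => ?_
      obtain ⟨v1, v2, v3, v4⟩ := hv
      have := (hqs _ hdba p).mpr v4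
      simp_all

theorem truthBit_congr {A B : Prop} (h : A ↔ B) : truthBit A = truthBit B := by
  rw [propext h]

theorem wp_searchProg (hW : 3 + n + n * k + k * k + n * n + n * n + n * n + 4 ≤ W)
    (hd : ∀ q < n, ∀ a < k, d q a < n) (h : Marked n k f d g qs s)
    (hqs : ∀ r < n, ∀ q, (r, q) ∈ qs ↔ TableReach k f d (r, q)) {Q : ℕ → RamState → Prop}
    (hQ : ∀ t s', t ≤ n * (k * (k * 60 + 10) + 10) + 10 →
      s'.reg 0 = truthBit (∀ p < n, ∀ a < k, ∀ b < k, ¬ TableViolation k f d g p a b) → Q t s') :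
    WP W searchProg s Q := by
  have hk := Nat.le_mul_self k
  have hn := Nat.le_mul_self n
  simp only [searchProg, wp_block_cons, wp_const]
  refine ⟨by omega, by omega, ?_⟩
  refine wp_for (fun j s => s.reg 13 = j ∧ j ≤ n ∧ Marked n k f d g qs s ∧
    s.reg 0 = truthBit (∀ p < j, ∀ a < k, ∀ b < k, ¬ TableViolation k f d g p a b))
    n (k * (k * 60 + 10) + 9) ?_ ?_ ?_ ?_
  · rintro j s ⟨h1, h2, hm, -⟩
    exact ⟨h1, hm.layout.reg2, h2⟩
  · refine ⟨by simp [RamState.reg_setReg], Nat.zero_le _, h.congr ?_ rfl,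
      by simp [RamState.reg_setReg, truthBit]⟩
    intro x hx hx'
    simp only [RamState.reg_setReg]
    repeat rw [if_neg (by omega)]
  · rintro p s hp ⟨h13, -, hm, h0⟩
    simp only [wp_block_cons, wp_const]
    refine ⟨by omega, ?_⟩
    refine wp_for (fun j s => s.reg 14 = j ∧ j ≤ k ∧ Marked n k f d g qs s ∧ s.reg 13 = p ∧
      s.reg 0 = truthBit ((∀ p' < p, ∀ a < k, ∀ b < k, ¬ TableViolation k f d g p' a b) ∧
        ∀ a < j, ∀ b < k, ¬ TableViolation k f d g p a b)) k (k * 60 + 9) ?_ ?_ ?_ ?_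
    · rintro j s ⟨h1, h2, hm, -⟩
      exact ⟨h1, hm.layout.reg3, h2⟩
    · refine ⟨by simp [RamState.reg_setReg], Nat.zero_le _, hm.congr ?_ rfl,
        by simp [RamState.reg_setReg, h13], by simpa [RamState.reg_setReg] using h0⟩
      intro x hx hx'
      rw [RamState.reg_setReg, if_neg (by omega)]
    · rintro a s ha ⟨h14, -, hm, h13, h0⟩
      simp only [wp_block_cons, wp_const]
      refine ⟨by omega, ?_⟩
      refine wp_for (fun j s => s.reg 15 = j ∧ j ≤ k ∧ Marked n k f d g qs s ∧ s.reg 13 = p ∧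
        s.reg 14 = a ∧
        s.reg 0 = truthBit (((∀ p' < p, ∀ a < k, ∀ b < k, ¬ TableViolation k f d g p' a b) ∧
          ∀ a' < a, ∀ b < k, ¬ TableViolation k f d g p a' b) ∧
            ∀ b < j, ¬ TableViolation k f d g p a b)) k 59 ?_ ?_ ?_ ?_
      · rintro j s ⟨h1, h2, hm, -⟩
        exact ⟨h1, hm.layout.reg3, h2⟩
      · refine ⟨by simp [RamState.reg_setReg], Nat.zero_le _, hm.congr ?_ rfl,
          by simp [RamState.reg_setReg, h13], by simp [RamState.reg_setReg, h14],
          by simpa [RamState.reg_setReg] using h0⟩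
        intro x hx hx'
        rw [RamState.reg_setReg, if_neg (by omega)]
      · rintro b s hb ⟨h15, -, hm, h13, h14, h0⟩
        rw [wp_block_cons]
        refine wp_checkProg hW hd hm hqs hp ha hb h13 h14 h15 h0 fun t s' ht hm' hreg h0' => ?_
        simp only [wp_block_cons, wp_add, wp_block_nil, hreg 15 (by omega) (by omega), h15, hm'.layout.reg1]
        refine ⟨by omega, by omega, by simp [RamState.reg_setReg], hb, hm'.congr ?_ rfl,
          by simp [RamState.reg_setReg, hreg, h13], by simp [RamState.reg_setReg, hreg, h14], ?_⟩
        · intro x hx hx'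
          rw [RamState.reg_setReg, if_neg (by omega)]
        · rw [RamState.reg_setReg, if_neg (by omega), h0']
          refine truthBit_congr ?_
          rw [and_assoc, Nat.forall_lt_succ_right]
      · rintro t s' ht ⟨h15, -, hm, h13, h14, h0⟩
        simp only [wp_add, wp_block_nil, h14, hm.layout.reg1]
        refine ⟨by omega, by omega, by simp [RamState.reg_setReg], ha, hm.congr ?_ rfl,
          by simp [RamState.reg_setReg, h13], ?_⟩
        · intro x hx hx'
          rw [RamState.reg_setReg, if_neg (by omega)]
        · rw [RamState.reg_setReg, if_neg (by omega), h0]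
          refine truthBit_congr ?_
          rw [and_assoc, Nat.forall_lt_succ_right]
    · rintro t s' ht ⟨h14, -, hm, h13, h0⟩
      change t ≤ k * (k * 60 + 10) + 1 at ht
      simp only [wp_add, wp_block_nil, h13, hm.layout.reg1]
      refine ⟨by omega, by omega, by simp [RamState.reg_setReg], hp, hm.congr ?_ rfl, ?_⟩
      · intro x hx hx'
        rw [RamState.reg_setReg, if_neg (by omega)]
      · rw [RamState.reg_setReg, if_neg (by omega), h0]
        refine truthBit_congr ?_
        rw [Nat.forall_lt_succ_right]
  · rintro t s' ht ⟨-, -, hm, h0⟩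
    rw [wp_block_nil]
    change t ≤ n * (k * (k * 60 + 10) + 10) + 1 at ht
    exact hQ _ _ (by omega) h0

theorem wp_setupProg (hW : 3 + n + n * k + k * k + n * n + n * n + n * n + 4 ≤ W)
    (hreg : ∀ x, s.reg x = 0) (hn : s.mem 0 = n) (hk : s.mem 1 = k)
    (hf : ∀ q < n, s.mem (3 + q) = f q)
    (hd : ∀ q < n, ∀ a < k, s.mem (3 + n + (q * k + a)) = d q a)
    (hg : ∀ a < k, ∀ b < k, s.mem (3 + n + n * k + (a * k + b)) = g a b)
    (hz : ∀ i, 3 + n + n * k + k * k ≤ i → s.mem i = 0) {Q : ℕ → RamState → Prop}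
    (hQ : ∀ t s', t ≤ 14 → Marked n k f d g [] s' → s'.reg 12 = 0 → s'.reg 13 = 0 → Q t s') :
    WP W setupProg s Q := by
  simp only [setupProg, wp_block_cons, wp_block_nil, wp_const, wp_load, wp_add, wp_mul,
    RamState.reg_setReg, RamState.mem_setReg, hreg, hn, hk, Nat.reduceEqDiff, reduceIte]
  refine ⟨by omega, by omega, by omega, by omega, by omega, by omega, by omega, by omega,
    by omega, by omega, by omega, ?_⟩
  refine hQ _ _ (by omega) ⟨⟨?_, ?_, ?_, ?_, ?_, ?_, ?_, ?_, ?_, ?_, hf, hd, hg⟩, ?_, by simp,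
    List.nodup_nil, by simp, ?_, by simp⟩ ?_ ?_
  case refine_12 =>
    intro r hr q hq
    simpa [RamState.mem_setReg] using hz _ (by omega)
  all_goals simp [RamState.reg_setReg, hreg]

/-- Correctness and running time of the program. -/
theorem wp_limitStableProg (hW : 3 + n + n * k + k * k + n * n + n * n + n * n + 4 ≤ W)
    (hn0 : 0 < n) (hk0 : 0 < k) (hdn : ∀ q < n, ∀ a < k, d q a < n)
    (hreg : ∀ x, s.reg x = 0) (hn : s.mem 0 = n) (hk : s.mem 1 = k)
    (hf : ∀ q < n, s.mem (3 + q) = f q)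
    (hd : ∀ q < n, ∀ a < k, s.mem (3 + n + (q * k + a)) = d q a)
    (hg : ∀ a < k, ∀ b < k, s.mem (3 + n + n * k + (a * k + b)) = g a b)
    (hz : ∀ i, 3 + n + n * k + k * k ≤ i → s.mem i = 0) :
    WP W limitStableProg s (fun t s' => t ≤ 200 * (n * n * (k * k)) ∧
      s'.reg 0 = truthBit (∀ p < n, ∀ a < k, ∀ b < k, ¬ TableViolation k f d g p a b)) := by
  simp only [limitStableProg, wp_block_cons, wp_block_nil]
  refine wp_setupProg hW hreg hn hk hf hd hg hz fun t₁ s₁ ht₁ hm₁ h12 h13 => ?_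
  refine wp_seedProg hW hm₁ h12 h13 fun t₂ s₂ qs₂ ht₂ hm₂ h12 hs => ?_
  refine wp_closeProg hW hdn hm₂ h12 hs fun t₃ s₃ qs₃ ht₃ hm₃ hqs => ?_
  refine wp_searchProg hW hdn hm₃ hqs fun t₄ s₄ ht₄ h0 => ⟨?_, h0⟩
  have h : n * 30 + 1 + (n * n * (k * 30 + 11) + 1) + (n * (k * (k * 60 + 10) + 10) + 10) + 20 ≤
      200 * (n * n * (k * k)) := by
    have h1 : n ≤ n * n := Nat.le_mul_self n
    have h2 : k ≤ k * k := Nat.le_mul_self k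
    have h3 : 1 ≤ k * k := Nat.mul_pos hk0 hk0
    have h4 : n * n ≤ n * n * (k * k) := Nat.le_mul_of_pos_right _ h3
    have h5 : n * n * k ≤ n * n * (k * k) := Nat.mul_le_mul_left _ h2
    have h6 : n * (k * k) ≤ n * n * (k * k) := Nat.mul_le_mul_right _ h1
    have h7 : n * k ≤ n * n * k := Nat.mul_le_mul_right _ h1
    linarith
  omega

end Correctness

section Encoding

variable {k n : ℕ} (I : Fin k → Fin k → Prop) (M : DFA (Fin k) (Fin n))

theorem length_encodeInput : (encodeInput I M).length = 3 + n + n * k + k * k := by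
  simp only [encodeInput, List.length_append, List.length_ofFn, List.length_cons, List.length_nil]

theorem encodeInput_final (q : Fin n) :
    (encodeInput I M)[3 + q.1]? = some (truthBit (q ∈ M.accept)) := by
  have hq := q.2
  rw [encodeInput, List.getElem?_append_left (by simp; omega),
    List.getElem?_append_left (by simp; omega), List.getElem?_append_right (by simp)]
  simp

theorem encodeInput_step (q : Fin n) (a : Fin k) :
    (encodeInput I M)[3 + n + (q.1 * k + a.1)]? = some (M.step q a).1 := by
  have h := mul_add_lt_mul q.2 a.2
  have hk : 0 < k := a.pos
  rw [encodeInput, List.getElem?_append_left (by simp; omega),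
    List.getElem?_append_right (by simp; omega)]
  have e : ∀ x, 3 + n + x - ([n, k, (M.start : ℕ)] ++
      List.ofFn fun q : Fin n => truthBit (q ∈ M.accept)).length = x := by
    intro x
    simp
    omega
  rw [e, List.getElem?_ofFn, dif_pos h]
  have h1 : (⟨q.1 * k + a.1, h⟩ : Fin (n * k)).divNat = q := by
    ext
    change (q.1 * k + a.1) / k = q.1
    rw [Nat.mul_comm, Nat.mul_add_div hk, Nat.div_eq_of_lt a.2, Nat.add_zero]
  have h2 : (⟨q.1 * k + a.1, h⟩ : Fin (n * k)).modNat = a := by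
    ext
    change (q.1 * k + a.1) % k = a.1
    rw [Nat.mul_add_mod_self_right, Nat.mod_eq_of_lt a.2]
  rw [h1, h2]

theorem encodeInput_indep (a b : Fin k) :
    (encodeInput I M)[3 + n + n * k + (a.1 * k + b.1)]? = some (truthBit (I a b)) := by
  have h := mul_add_lt_mul a.2 b.2
  have hk : 0 < k := a.pos
  rw [encodeInput, List.getElem?_append_right (by simp; omega)]
  have e : ∀ x, 3 + n + n * k + x - ([n, k, (M.start : ℕ)] ++
      (List.ofFn fun q : Fin n => truthBit (q ∈ M.accept)) ++
      List.ofFn fun i : Fin (n * k) => (M.step i.divNat i.modNat : ℕ)).length = x := by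
    intro x
    simp
    omega
  rw [e, List.getElem?_ofFn, dif_pos h]
  have h1 : (⟨a.1 * k + b.1, h⟩ : Fin (k * k)).divNat = a := by
    ext
    change (a.1 * k + b.1) / k = a.1
    rw [Nat.mul_comm, Nat.mul_add_div hk, Nat.div_eq_of_lt b.2, Nat.add_zero]
  have h2 : (⟨a.1 * k + b.1, h⟩ : Fin (k * k)).modNat = b := by
    ext
    change (a.1 * k + b.1) % k = b.1
    rw [Nat.mul_add_mod_self_right, Nat.mod_eq_of_lt b.2]
  rw [h1, h2]

/-- The table of final states. -/
noncomputable def finalTable (q : ℕ) : ℕ :=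
  if h : q < n then truthBit ((⟨q, h⟩ : Fin n) ∈ M.accept) else 0

/-- The transition table. -/
def stepTable (q a : ℕ) : ℕ :=
  if h : q < n ∧ a < k then (M.step ⟨q, h.1⟩ ⟨a, h.2⟩).1 else 0

/-- The table of the independence relation. -/
noncomputable def indepTable (a b : ℕ) : ℕ :=
  if h : a < k ∧ b < k then truthBit (I ⟨a, h.1⟩ ⟨b, h.2⟩) else 0

theorem truthBit_eq_one {A : Prop} : truthBit A = 1 ↔ A := by
  simp [truthBit]

theorem truthBit_eq_zero {A : Prop} : truthBit A = 0 ↔ ¬ A := by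
  simp [truthBit]

theorem finalTable_coe (q : Fin n) : finalTable M q.1 = truthBit (q ∈ M.accept) := by
  simp [finalTable]

theorem stepTable_coe (q : Fin n) (a : Fin k) : stepTable M q.1 a.1 = (M.step q a).1 := by
  simp [stepTable]

theorem indepTable_coe (a b : Fin k) : indepTable I a.1 b.1 = truthBit (I a b) := by
  simp [indepTable]

theorem tableReach_iff (q q' : Fin n) :
    TableReach k (finalTable M) (stepTable M) (q.1, q'.1) ↔
      q ∉ M.accept ∧ ReflTransGen (AvoidStep M) q q' := by
  rw [TableReach, finalTable_coe, truthBit_eq_zero]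
  refine and_congr_right fun _ => ⟨fun h => ?_, fun h => ?_⟩
  · have key : ∀ x, ReflTransGen (TableStep k (finalTable M) (stepTable M)) q.1 x →
        ∃ y : Fin n, y.1 = x ∧ ReflTransGen (AvoidStep M) q y := by
      intro x hx
      induction hx with
      | refl => exact ⟨q, rfl, .refl⟩
      | tail _ hstep ih =>
        obtain ⟨y, rfl, hy⟩ := ih
        obtain ⟨hf, a, ha, rfl⟩ := hstep
        have e := stepTable_coe M y ⟨a, ha⟩
        dsimp only at e
        rw [e, finalTable_coe, truthBit_eq_zero] at hf
        exact ⟨_, e.symm, hy.tail ⟨hf, _, rfl⟩⟩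
    obtain ⟨y, hy, h⟩ := key _ h
    rwa [← Fin.ext hy]
  · refine ReflTransGen.lift (fun q : Fin n => q.1) ?_ _ _ h
    rintro x _ ⟨hf, a, rfl⟩
    refine ⟨?_, a.1, a.2, stepTable_coe M x a⟩
    rwa [finalTable_coe, truthBit_eq_zero]

theorem tableViolation_iff (p : Fin n) (a b : Fin k) :
    TableViolation k (finalTable M) (stepTable M) (indepTable I) p.1 a.1 b.1 ↔
      I a b ∧ M.step p a ∈ M.accept ∧ M.step p b ∉ M.accept ∧
        M.step (M.step p b) a ∉ M.accept ∧
          ReflTransGen (AvoidStep M) (M.step (M.step p b) a) p := by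
  rw [TableViolation, stepTable_coe, stepTable_coe, stepTable_coe, indepTable_coe, finalTable_coe,
    finalTable_coe, tableReach_iff, truthBit_eq_one, truthBit_eq_one, truthBit_eq_zero]

theorem hasUnstableSwap_iff_tableViolation : HasUnstableSwap I M ↔
    ∃ p < n, ∃ a < k, ∃ b < k,
      TableViolation k (finalTable M) (stepTable M) (indepTable I) p a b := by
  constructor
  · rintro ⟨p, a, b, h1, h2, -, h3, h4, h5⟩
    exact ⟨p.1, p.2, a.1, a.2, b.1, b.2, (tableViolation_iff I M p a b).mpr ⟨h1, h2, h3, h4, h5⟩⟩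
  · rintro ⟨p, hp, a, ha, b, hb, h⟩
    obtain ⟨h1, h2, h3, h4, h5⟩ := (tableViolation_iff I M ⟨p, hp⟩ ⟨a, ha⟩ ⟨b, hb⟩).mp h
    refine ⟨_, _, _, h1, h2, ?_, h3, h4, h5⟩
    rcases ReflTransGen.cases_tail h5 with h | ⟨_, _, h⟩
    · rw [h]
      exact h4
    · exact h.1

end Encoding

theorem mainTheorem6 :
    ∃ (P : RamProg) (c : ℕ) (C : ℝ),
      ∀ (k n : ℕ), 0 < k →
      ∀ (I : Fin k → Fin k → Prop), IsIndependence I →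
      ∀ (T : Set (FiniteTrace I)), IsRecognizable T →
      ∀ (M : DFA (Fin k) (Fin n)), IsMinimalDFA M (linearizations T) →
      ∃ (t : ℕ) (s : RamState),
        RamExec (((encodeInput I M).length + 2) ^ c) P (ramInit (encodeInput I M)) t s ∧
        s.reg 0 = truthBit (LimitStable I (linearizations T)) ∧
        (t : ℝ) ≤ C * ((n : ℝ) ^ 2 * (k : ℝ) * ((k : ℝ) + Real.log (n : ℝ))) := by
  refine ⟨limitStableProg, 3, 200, ?_⟩
  intro k n hk I hI T _ M hM
  have hn : 0 < n := M.start.pos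
  have hW : 3 + n + n * k + k * k + n * n + n * n + n * n + 4 ≤
      ((encodeInput I M).length + 2) ^ 3 := by
    rw [length_encodeInput]
    have h1 : n ≤ 3 + n + n * k + k * k + 2 := by omega
    have h2 := Nat.mul_le_mul h1 h1
    generalize hX : 3 + n + n * k + k * k + 2 = X at *
    have h3 : 5 * (X * X) ≤ X ^ 3 := by
      rw [pow_succ, pow_two, Nat.mul_comm 5]
      exact Nat.mul_le_mul_left _ (by omega)
    have h4 : 5 * X ≤ X * X := Nat.mul_le_mul_right _ (by omega)
    omega
  have hmem : ∀ {i v : ℕ}, (encodeInput I M)[i]? = some v → (ramInit (encodeInput I M)).mem i = v := by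
    intro i v h
    simp [ramInit, List.getD_eq_getElem?_getD, h]
  obtain ⟨t, s, hex, ht, h0⟩ := wp_limitStableProg (f := finalTable M) (d := stepTable M)
    (g := indepTable I) hW hn hk
    (fun q hq a ha => by
      have := stepTable_coe M ⟨q, hq⟩ ⟨a, ha⟩
      dsimp only at this
      rw [this]
      exact (M.step _ _).2)
    (fun _ => rfl) (hmem (by simp [encodeInput])) (hmem (by simp [encodeInput]))
    (fun q hq => (hmem (encodeInput_final I M ⟨q, hq⟩)).trans (finalTable_coe M ⟨q, hq⟩).symm)
    (fun q hq a ha => (hmem (encodeInput_step I M ⟨q, hq⟩ ⟨a, ha⟩)).trans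
      (stepTable_coe M ⟨q, hq⟩ ⟨a, ha⟩).symm)
    (fun a ha b hb => (hmem (encodeInput_indep I M ⟨a, ha⟩ ⟨b, hb⟩)).trans
      (indepTable_coe I ⟨a, ha⟩ ⟨b, hb⟩).symm)
    (fun i hi => by
      have : (encodeInput I M)[i]? = none :=
        List.getElem?_eq_none (by rw [length_encodeInput]; exact hi)
      simp [ramInit, List.getD_eq_getElem?_getD, this])
  refine ⟨t, s, hex, ?_, ?_⟩
  · rw [h0]
    refine truthBit_congr ?_
    rw [limitStable_iff hI T hM, hasUnstableSwap_iff_tableViolation]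
    push Not
    rfl
  · have h1 : (t : ℝ) ≤ 200 * (n * n * (k * k)) := by exact_mod_cast ht
    have h2 : 0 ≤ Real.log n := Real.log_natCast_nonneg n
    refine h1.trans ?_
    have h3 : (0 : ℝ) ≤ (n : ℝ) ^ 2 * k * Real.log n := by positivity
    nlinarith
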